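/- Let $K$ be an infinite field, $R=K[x_0,\dots,x_n]$ with the standard grading, and $\mathfrak m=(x_0,\dots,x_n)$. For a homogeneous ideal $I$ let $h_{R/I}(j)=\dim_K[R/I]_j$, and let its $h$-vector be $a=\Delta^{n-1}h_{R/I}$, where $\Delta f(j)=f(j)-f(j-1)$ and $f(-1)=0$. An ideal $J=G\cdot I+(F)$ is a \emph{basic double link} of $I$ of type $(d,b)$, and of height $b$, if $0\ne F\in I$ is a form of degree $d$ and $G\neq 0$ is a form of degree $b$ without common factors with $F$ (so a general $G$ is allowed). \emph{First algorithm.} Take a graded minimal free resolution $\cdots\to\bigoplus_k R(-c_{2,k})\to\bigoplus_k R(-c_{1,k})\to R\to R/I\to 0$. Let $\underline r$ be the multiset of all $c_{p,k}$ with $p\ge 1$ odd and $\underline s$ the multiset of all $c_{p,k}$ with $p\ge 2$ even. Remove common elements of $\underline r$ and $\underline s$ pairwise, one at a time, and order the remaining elements as $s_1\ge s_2\ge\cdots$ and $r_1\ge r_2\ge\cdots$. Let $-d_1,\dots,-d_\ell$ be the negative entries $s_i-r_i$ on the main diagonal of the matrix $(s_i-r_j)$, listed from the bottom right to the top left. If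 there are none, stop. Otherwise let $s_{i_1}-r_{i_1}=-d_1$ be the first of them, replace $I$ by a basic double link of type $(r_{i_1},d_1)$, and repeat. \emph{Second algorithm.} Let $a$ be the $h$-vector of $R/I$. If $a$ is an O-sequence, stop. Otherwise let $i$ be the smallest index with $a_i\le i$ and $a_i<a_{i+1}$, replace $I$ by a basic double link of type $(i+2,1)$, and repeat. The \emph{deficit} of $R/I$ is $\delta=\sum_{i\ge\alpha}\max\{0,a_{i+1}-a_i\}$, where $\alpha$ is the least index with $a_\alpha\le\alpha$. \textbf{Proposition.} Let $I\subset R$ be a homogeneous ideal of codimension at least two such that $R/I$ is not Cohen--Macaulay. Let $J$ be the output of any run of the first algorithm on $I$, and $J'$ the output of any run of the second algorithm on $I$. Then: \begin{enumerate} \item $h_{R/J}(j)=h_{R/J'}(j)$ for all $j$. \item The $h$-vector of $R/I$ has only finitely many nonzero entries, and the following three numbers are equal to the deficit $\delta$ of $R/I$: the sum of the heights of the basic double links performed in the first algorithm, the sum $\sum_i d_i$ over the negative diagonal entries $-d_i$ obtained from $I$ itself, and the number of basic double links performed in the second algorithm. \item For all $i\le n-2$ there is an isomorphism of graded $R$-modules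 $H^i_{\mathfrak m}(R/J)\cong H^i_{\mathfrak m}(R/J')$. \end{enumerate} -/

import Mathlib

open MvPolynomial

attribute [local instance] MvPolynomial.gradedAlgebra

namespace NumMac

noncomputable section

/-! ### Hilbert functions, `h`-vectors and O-sequences

Throughout, the polynomial ring `K[x_0, …, x_n]` is `MvPolynomial (Fin (n + 1)) K` with its standard
grading. -/

/-- The degree `j` component `[R/I]_j` of `R/I`. -/
def quotientPiece {K : Type*} [Field K] {n : ℕ} (I : Ideal (MvPolynomial (Fin (n + 1)) K)) (j : ℕ) :
    Submodule K (MvPolynomial (Fin (n + 1)) K ⧸ I) :=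
  (homogeneousSubmodule (Fin (n + 1)) K j).map (Ideal.Quotient.mkₐ K I).toLinearMap

/-- The Hilbert function `h_{R/I}(j) = dim_K [R/I]_j`. -/
def hilbertFunction {K : Type*} [Field K] {n : ℕ} (I : Ideal (MvPolynomial (Fin (n + 1)) K))
    (j : ℕ) : ℕ :=
  Module.finrank K (quotientPiece I j)

/-- The first difference `Δ f (j) = f (j) - f (j - 1)`, with the convention `f (-1) = 0`. -/
def difference (f : ℕ → ℤ) : ℕ → ℤ
  | 0 => f 0
  | j + 1 => f (j + 1) - f j

/-- The `h`-vector of `R/I`: the `(n-1)`-st difference of its Hilbert function (extended by `0`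
after its last nonzero value). -/
def hVector {K : Type*} [Field K] {n : ℕ} (I : Ideal (MvPolynomial (Fin (n + 1)) K)) : ℕ → ℤ :=
  difference^[n - 1] (fun j => (hilbertFunction I j : ℤ))

/-- `macaulayBound i c` is Macaulay's bound `c^{<i>}`: if
`c = C(k_i, i) + C(k_{i-1}, i-1) + ⋯ + C(k_t, t)` with `k_i > k_{i-1} > ⋯ > k_t ≥ t ≥ 1` is the `i`-th
binomial expansion of `c`, which is computed greedily, then
`c^{<i>} = C(k_i + 1, i + 1) + C(k_{i-1} + 1, i) + ⋯ + C(k_t + 1, t + 1)`, and `0^{<i>} = 0`. -/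
def macaulayBound : ℕ → ℕ → ℕ
  | 0, _ => 0
  | i + 1, c =>
    if c = 0 then 0
    else
      let k := Nat.findGreatest (fun k => k.choose (i + 1) ≤ c) (c + i + 1)
      (k + 1).choose (i + 2) + macaulayBound i (c - k.choose (i + 1))

/-- O-sequences: `a_0 = 1`, all `a_i ≥ 0`, and `a_{i+1} ≤ a_i^{<i>}` for all `i ≥ 1`. -/
def IsOSequence (a : ℕ → ℤ) : Prop :=
  a 0 = 1 ∧ (∀ i, 0 ≤ a i) ∧ ∀ i, 1 ≤ i → a (i + 1) ≤ (macaulayBound i (a i).toNat : ℤ)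

/-- The deficit of `R/I`: the sum of `max {0, a_{i+1} - a_i}` over all indices `i` that are at least
the least index `j` with `a_j ≤ j`, where `a` is the `h`-vector of `R/I`. -/
def deficit {K : Type*} [Field K] {n : ℕ} (I : Ideal (MvPolynomial (Fin (n + 1)) K)) : ℤ :=
  ∑ᶠ i ∈ {i : ℕ | ∃ j ≤ i, hVector I j ≤ (j : ℤ)}, max 0 (hVector I (i + 1) - hVector I i)

/-! ### Cohen-Macaulay ideals -/

/-- `I` is Cohen-Macaulay, i.e. `depth R/I ≥ dim R/I`: the irrelevant maximal ideal contains an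
`R/I`-regular sequence of length at least `dim R/I` (the zero ring `R/R` counts as
Cohen-Macaulay). -/
def IsCohenMacaulayIdeal {K : Type*} [Field K] {n : ℕ}
    (I : Ideal (MvPolynomial (Fin (n + 1)) K)) : Prop :=
  ∃ fs : List (MvPolynomial (Fin (n + 1)) K),
    (∀ f ∈ fs, f ∈ Ideal.span (Set.range (X : Fin (n + 1) → MvPolynomial (Fin (n + 1)) K))) ∧
    RingTheory.Sequence.IsWeaklyRegular (MvPolynomial (Fin (n + 1)) K ⧸ I) fs ∧
    ringKrullDim (MvPolynomial (Fin (n + 1)) K ⧸ I) ≤ (fs.length : WithBot ℕ∞)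

/-! ### Minimal free resolutions -/

/-- A graded minimal free resolution
`0 → F_length → ⋯ → F_2 → F_1 → F_0 = R → R/I → 0`, where `F_p = ⨁_k R(-shift p k)` and where the
matrix `diff p` represents `F_{p+1} → F_p`. -/
structure MinimalFreeResolution {K : Type*} [Field K] {n : ℕ}
    (I : Ideal (MvPolynomial (Fin (n + 1)) K)) where
  length : ℕ
  rank : ℕ → ℕ
  shift : (p : ℕ) → Fin (rank p) → ℕ
  diff : (p : ℕ) → Matrix (Fin (rank p)) (Fin (rank (p + 1))) (MvPolynomial (Fin (n + 1)) K)
  rank_zero : rank 0 = 1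
  shift_zero : ∀ k, shift 0 k = 0
  rank_eq_zero : ∀ p, length < p → rank p = 0
  homogeneous : ∀ p k l, diff p k l = 0 ∨
    ∃ e, shift p k + e = shift (p + 1) l ∧ (diff p k l).IsHomogeneous e
  span_eq : Ideal.span {f | ∃ k l, f = diff 0 k l} = I
  exact : ∀ p, LinearMap.range (diff (p + 1)).mulVecLin = LinearMap.ker (diff p).mulVecLin
  minimal : ∀ p k l, constantCoeff (diff p k l) = 0

namespace MinimalFreeResolution

variable {K : Type*} [Field K] {n : ℕ} {I : Ideal (MvPolynomial (Fin (n + 1)) K)}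

/-- The twists `c_{p,k}` of the module `F_p`. -/
def shifts (res : MinimalFreeResolution I) (p : ℕ) : Multiset ℕ :=
  Finset.univ.val.map (res.shift p)

/-- The twists `c_{p,k}` with `p ≥ 1` odd. -/
def oddShifts (res : MinimalFreeResolution I) : Multiset ℕ :=
  ∑ p ∈ Finset.Icc 1 res.length with Odd p, res.shifts p

/-- The twists `c_{p,k}` with `p ≥ 2` even. -/
def evenShifts (res : MinimalFreeResolution I) : Multiset ℕ :=
  ∑ p ∈ Finset.Icc 1 res.length with Even p, res.shifts p

/-- The list `r_1 ≥ r_2 ≥ ⋯` after common elements have been removed pairwise (the difference of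
multisets is truncated). -/
def rList (res : MinimalFreeResolution I) : List ℕ :=
  (res.oddShifts - res.evenShifts).sort (· ≥ ·)

/-- The list `s_1 ≥ s_2 ≥ ⋯` after common elements have been removed pairwise. -/
def sList (res : MinimalFreeResolution I) : List ℕ :=
  (res.evenShifts - res.oddShifts).sort (· ≥ ·)

/-- The pairs `(s_i, r_i)` for which the entry `s_i - r_i` on the main diagonal of the matrix
`(s_i - r_j)` is negative, listed from the bottom right to the top left. -/
def negativeDiagonal (res : MinimalFreeResolution I) : List (ℕ × ℕ) :=
  ((List.zip res.sList res.rList).filter (fun q => q.1 < q.2)).reverse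

/-- The list `d_1, …, d_ℓ` of the absolute values `r_i - s_i` of the negative entries on the main
diagonal. -/
def negativeEntries (res : MinimalFreeResolution I) : List ℕ :=
  res.negativeDiagonal.map (fun q => q.2 - q.1)

end MinimalFreeResolution

/-! ### Basic double links and the two algorithms -/

/-- `J = G · I + (F)` is a basic double link of `I` of type `(d, a)`: `F ∈ I` is a nonzero form of
degree `d`, and `G` is a nonzero form of degree `a` without common factors with `F`, which is what
the generality of `G` means here. -/
def IsBasicDoubleLink {K : Type*} [Field K] {n : ℕ}
    (I J : Ideal (MvPolynomial (Fin (n + 1)) K)) (d a : ℕ) : Prop :=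
  ∃ F G : MvPolynomial (Fin (n + 1)) K,
    F ∈ I ∧ F ≠ 0 ∧ F.IsHomogeneous d ∧ G ≠ 0 ∧ G.IsHomogeneous a ∧ IsRelPrime F G ∧
    J = Ideal.span {G} * I ⊔ Ideal.span {F}

/-- `FirstAlgorithm I ds J`: some run of the first algorithm with input `I` stops with output `J`,
and `ds` lists the heights of the basic double links performed in it, in order. -/
inductive FirstAlgorithm {K : Type*} [Field K] {n : ℕ} :
    Ideal (MvPolynomial (Fin (n + 1)) K) → List ℕ → Ideal (MvPolynomial (Fin (n + 1)) K) → Prop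
  | finish (I : Ideal (MvPolynomial (Fin (n + 1)) K)) (res : MinimalFreeResolution I)
      (h : res.negativeDiagonal = []) : FirstAlgorithm I [] I
  | step (I I' J : Ideal (MvPolynomial (Fin (n + 1)) K)) (res : MinimalFreeResolution I)
      (s r : ℕ) (tail : List (ℕ × ℕ)) (ds : List ℕ)
      (h : res.negativeDiagonal = (s, r) :: tail)
      (link : IsBasicDoubleLink I I' r (r - s))
      (next : FirstAlgorithm I' ds J) : FirstAlgorithm I ((r - s) :: ds) J

/-- `SecondAlgorithm I m J`: some run of the second algorithm with input `I` stops with output `J`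
after `m` basic double links. -/
inductive SecondAlgorithm {K : Type*} [Field K] {n : ℕ} :
    Ideal (MvPolynomial (Fin (n + 1)) K) → ℕ → Ideal (MvPolynomial (Fin (n + 1)) K) → Prop
  | finish (I : Ideal (MvPolynomial (Fin (n + 1)) K))
      (h : IsOSequence (hVector I)) : SecondAlgorithm I 0 I
  | step (I I' J : Ideal (MvPolynomial (Fin (n + 1)) K)) (i m : ℕ)
      (h : ¬ IsOSequence (hVector I))
      (least : IsLeast {i : ℕ | hVector I i ≤ (i : ℤ) ∧ hVector I i < hVector I (i + 1)} i)
      (link : IsBasicDoubleLink I I' (i + 2) 1)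
      (next : SecondAlgorithm I' m J) : SecondAlgorithm I (m + 1) J

/-! ### Graded local cohomology, through the Čech complex on `x_0, …, x_n` -/

/-- The multiplicative set of all monomials in the variables `x_i`, `i ∈ S`. -/
def monomialsIn (K : Type*) [Field K] (n : ℕ) (S : Finset (Fin (n + 1))) :
    Submonoid (MvPolynomial (Fin (n + 1)) K) :=
  Submonoid.closure (X '' (S : Set (Fin (n + 1))))

theorem monomialsIn_mono (K : Type*) [Field K] {n : ℕ} {S T : Finset (Fin (n + 1))} (h : S ⊆ T) :
    monomialsIn K n S ≤ monomialsIn K n T :=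
  Submonoid.closure_mono (Set.image_mono (by exact_mod_cast h))

section Cech

variable (K : Type*) [Field K] (n : ℕ) (M : Type*) [AddCommGroup M]
  [Module (MvPolynomial (Fin (n + 1)) K) M]

/-- The `p`-th module `⨁_{|S| = p} M_{x_S}` of the Čech complex, where `x_S = ∏_{i ∈ S} x_i`. -/
abbrev CechModule (p : ℕ) : Type _ :=
  (S : {S : Finset (Fin (n + 1)) // S.card = p}) → LocalizedModule (monomialsIn K n S.1) M

/-- The Čech differential: `(d c)_T = ∑_{i ∈ T} (-1)^{#{j ∈ T | j < i}} c_{T ∖ {i}}`. -/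
def cechDifferential (p : ℕ) :
    CechModule K n M p →ₗ[MvPolynomial (Fin (n + 1)) K] CechModule K n M (p + 1) :=
  LinearMap.pi fun T => ∑ i : {i // i ∈ T.1},
    ((-1 : ℤ) ^ (T.1.filter (fun j => j < i.1)).card) •
      (LocalizedModule.liftOfLE (M := M) (monomialsIn K n (T.1.erase i.1)) (monomialsIn K n T.1)
        (monomialsIn_mono K (Finset.erase_subset _ _))).comp
        (LinearMap.proj (⟨T.1.erase i.1, by
          rw [Finset.card_erase_of_mem i.2, T.2, Nat.add_sub_cancel]⟩ :
            {S : Finset (Fin (n + 1)) // S.card = p}))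

/-- The coboundaries in the `p`-th module of the Čech complex. -/
def cechBoundaries : (p : ℕ) → Submodule (MvPolynomial (Fin (n + 1)) K) (CechModule K n M p)
  | 0 => ⊥
  | p + 1 => LinearMap.range (cechDifferential K n M p)

/-- The local cohomology module `H^p_𝔪(M)`, `𝔪 = (x_0, …, x_n)`. -/
abbrev LocalCohomology (p : ℕ) : Type _ :=
  LinearMap.ker (cechDifferential K n M p) ⧸
    (cechBoundaries K n M p).comap (LinearMap.ker (cechDifferential K n M p)).subtype

variable {K n M}

/-- For `M` graded with components `ℳ j`, the elements of degree `d` of the localization `M_{x_S}`: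
the fractions `m / s` with `m` of degree `j`, `s` of degree `e`, and `j - e = d`. -/
def localizedPiece [Module K M] (ℳ : ℕ → Submodule K M) (S : Finset (Fin (n + 1))) (d : ℤ) :
    Set (LocalizedModule (monomialsIn K n S) M) :=
  {y | ∃ (m : M) (s : monomialsIn K n S) (j e : ℕ), m ∈ ℳ j ∧
    s.1.IsHomogeneous e ∧ (j : ℤ) - e = d ∧ y = LocalizedModule.mk m s}

/-- The component of degree `d` of `H^p_𝔪(M)`: the classes of the cocycles of degree `d`. -/
def localCohomologyPiece [Module K M] (ℳ : ℕ → Submodule K M) (p : ℕ) (d : ℤ) :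
    Set (LocalCohomology K n M p) :=
  {x | ∃ c : LinearMap.ker (cechDifferential K n M p),
    (∀ S, c.1 S ∈ localizedPiece ℳ S.1 d) ∧ Submodule.Quotient.mk c = x}

end Cech

/-- There is an isomorphism of graded `R`-modules `H^p_𝔪(R/I) ≅ H^p_𝔪(R/J)`. -/
def GradedLocalCohomologyIso {K : Type*} [Field K] {n : ℕ}
    (I J : Ideal (MvPolynomial (Fin (n + 1)) K)) (p : ℕ) : Prop :=
  ∃ e : LocalCohomology K n (MvPolynomial (Fin (n + 1)) K ⧸ I) p
      ≃ₗ[MvPolynomial (Fin (n + 1)) K] LocalCohomology K n (MvPolynomial (Fin (n + 1)) K ⧸ J) p,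
    ∀ (d : ℤ) (x : LocalCohomology K n (MvPolynomial (Fin (n + 1)) K ⧸ I) p),
      x ∈ localCohomologyPiece (quotientPiece I) p d ↔
        e x ∈ localCohomologyPiece (quotientPiece J) p d

end

end NumMac

/-!
Write `D = Δ^n h_{R/I}` (`hDiff`) for the first difference of the `h`-vector of `R/I`, and `α` for
the initial degree of `I`. Then `D` is `1` below `α`, not positive at `α` and, as the `h`-vector is
finite, eventually `0` (`IsProfile`); the deficit is the sum of the positive parts of `D` from `α`
on (`deficit_eq_sum`). Everything happens to `D`.

A basic double link of type `(d, b)` shifts `D` by `b` places and lowers it by `1` at the `b` places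
that come from `[d - b, d)` (`IsBasicDoubleLink.hDiff_add`). In both algorithms the type is such
that `D` is positive on `[d - b, d)` and `α ≤ d - b`. This is plain for the second one, where `b = 1`
and `D (d - 1) = a_{i+1} - a_i` with `d = i + 2`. For the first one, the resolution gives
`D j = #{r > j} - #{s > j}` after cancellation of common shifts
(`MinimalFreeResolution.hDiff_eq_countP_sub_countP`, from
`MinimalFreeResolution.difference_hDiff_eq`). As both lists are sorted, exactly `max 0 (D j)` of
the diagonal pairs satisfy `s ≤ j < r` (`MinimalFreeResolution.countP_zip_eq_max_hDiff`). Hence `D`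
is positive on `[s, r)` for every negative diagonal entry `s - r`, and summation over `j` shows that
the absolute values of the negative entries add up to the deficit.

So a step of height `b` lowers the deficit by `b` and leaves `min 0 D` alone, up to the shift. A run
ends only when the deficit is `0`: without negative diagonal entries the sum above is empty, and an
O-sequence does not increase once `a_i ≤ i`. Therefore the heights add up to the deficit `δ`, and
the output has `D j = 1` for `j < α + δ` and `D (j + δ) = min 0 (D_I j)` for `j ≥ α`, whatever
the run (`IsReduction`). The function `D` determines the Hilbert function.

A basic double link comes with an exact sequence `0 → (R/I)(-b) → R/J → R/(F, G) → 0`. The complete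
intersection `R/(F, G)` has no local cohomology in degrees at most `n - 2`
(`cechAcyclic_quotient_span_sup_span`), which is shown on the Čech complex by induction on regular
sequences, so that a run of total height `δ` shifts the local cohomology in these degrees by `δ`
(`ShiftedCohomologyIso.of_quotientMul`). Gradings on local cohomology are handled through the
projections onto graded components, which act on the Čech complex.

The finiteness of the `h`-vector (`hVector_eventually_zero`) uses the codimension: by homogeneous
prime avoidance `I` contains two coprime forms, and the Hilbert function of `R/I` lies between `0`
and that of the complete intersection they define.
-/

namespace NumMac

noncomputable section

/-! ### The Čech complex and its functoriality -/

section Cech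

variable {K : Type*} [Field K] {n : ℕ}
  {M : Type*} [AddCommGroup M] [Module (MvPolynomial (Fin (n + 1)) K) M]
  {N : Type*} [AddCommGroup N] [Module (MvPolynomial (Fin (n + 1)) K) N]
  {P : Type*} [AddCommGroup P] [Module (MvPolynomial (Fin (n + 1)) K) P]

theorem liftOfLE_mk {S T : Finset (Fin (n + 1))} (h : S ⊆ T) (m : M)
    (s : monomialsIn K n S) :
    LocalizedModule.liftOfLE (M := M) (monomialsIn K n S) (monomialsIn K n T)
      (monomialsIn_mono K h) (LocalizedModule.mk m s) =
      LocalizedModule.mk m ⟨s.1, monomialsIn_mono K h s.2⟩ := by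
  rw [IsLocalizedModule.mk_eq_mk', IsLocalizedModule.liftOfLE_mk', IsLocalizedModule.mk_eq_mk']

/-- The component of a cochain `c` at `S`, restricted to the localization at `U`; it is `0` unless
`S ⊆ U` and `S` has the size of the indices of `c`. It makes the terms of the Čech
differential functions of plain finite sets. -/
def cechValue {p : ℕ} (c : CechModule K n M p) (U S : Finset (Fin (n + 1))) :
    LocalizedModule (monomialsIn K n U) M :=
  if h : S ⊆ U ∧ S.card = p then
    LocalizedModule.liftOfLE (M := M) (monomialsIn K n S) (monomialsIn K n U)
      (monomialsIn_mono K h.1) (c ⟨S, h.2⟩)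
  else 0

variable (K) in
/-- The sign `(-1)^{#{j ∈ T | j < i}}` of the Čech differential, as a polynomial. -/
def cechSign (T : Finset (Fin (n + 1))) (i : Fin (n + 1)) : MvPolynomial (Fin (n + 1)) K :=
  (-1) ^ (T.filter (fun j => j < i)).card

theorem liftOfLE_liftOfLE {S T U : Finset (Fin (n + 1))} (h : S ⊆ T) (h' : T ⊆ U)
    (y : LocalizedModule (monomialsIn K n S) M) :
    LocalizedModule.liftOfLE (M := M) (monomialsIn K n T) (monomialsIn K n U)
      (monomialsIn_mono K h') (LocalizedModule.liftOfLE (M := M) (monomialsIn K n S)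
        (monomialsIn K n T) (monomialsIn_mono K h) y) =
    LocalizedModule.liftOfLE (M := M) (monomialsIn K n S) (monomialsIn K n U)
      (monomialsIn_mono K (h.trans h')) y := by
  induction y using LocalizedModule.induction_on with
  | h m s => rw [liftOfLE_mk h, liftOfLE_mk h', liftOfLE_mk (h.trans h')]

theorem liftOfLE_cechValue {p : ℕ} (c : CechModule K n M p) {S T U : Finset (Fin (n + 1))}
    (hS : S ⊆ T) (hT : T ⊆ U) :
    LocalizedModule.liftOfLE (M := M) (monomialsIn K n T) (monomialsIn K n U)
      (monomialsIn_mono K hT) (cechValue c T S) = cechValue c U S := by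
  unfold cechValue
  by_cases hc : S.card = p
  · rw [dif_pos ⟨hS, hc⟩, dif_pos ⟨hS.trans hT, hc⟩, liftOfLE_liftOfLE hS hT]
  · rw [dif_neg (fun h => hc h.2), dif_neg (fun h => hc h.2), map_zero]

theorem cechDifferential_apply {p : ℕ} (c : CechModule K n M p)
    (T : {S : Finset (Fin (n + 1)) // S.card = p + 1}) :
    cechDifferential K n M p c T = ∑ i ∈ T.1, cechSign K T.1 i • cechValue c T.1 (T.1.erase i) := by
  have key : ∀ i : {i // i ∈ T.1}, cechValue c T.1 (T.1.erase i.1) =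
      (LocalizedModule.liftOfLE (M := M) (monomialsIn K n (T.1.erase i.1)) (monomialsIn K n T.1)
        (monomialsIn_mono K (Finset.erase_subset _ _))) (c ⟨T.1.erase i.1, by
          rw [Finset.card_erase_of_mem i.2, T.2, Nat.add_sub_cancel]⟩) := by
    intro i
    rw [cechValue, dif_pos ⟨Finset.erase_subset _ _, by
          rw [Finset.card_erase_of_mem i.2, T.2, Nat.add_sub_cancel]⟩]
  rw [← Finset.sum_coe_sort T.1
    (fun i => cechSign K T.1 i • cechValue c T.1 (T.1.erase i))]
  simp only [key, cechDifferential, LinearMap.pi_apply, LinearMap.sum_apply]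
  refine Finset.sum_congr rfl fun i _ => ?_
  rcases Nat.even_or_odd (T.1.filter (fun j => j < i.1)).card with h | h
  · simp [cechSign, h.neg_one_pow]
  · simp [cechSign, h.neg_one_pow]

theorem cechValue_cechDifferential {p : ℕ} (c : CechModule K n M p)
    {T U : Finset (Fin (n + 1))} (hT : T ⊆ U) (hc : T.card = p + 1) :
    cechValue (cechDifferential K n M p c) U T =
      ∑ i ∈ T, cechSign K T i • cechValue c U (T.erase i) := by
  rw [cechValue, dif_pos ⟨hT, hc⟩, cechDifferential_apply, map_sum]
  refine Finset.sum_congr rfl fun i _ => ?_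
  rw [map_smul, liftOfLE_cechValue c (Finset.erase_subset _ _) hT]

theorem cechSign_mul_cechSign_erase {U : Finset (Fin (n + 1))} {i j : Fin (n + 1)} (hi : i ∈ U)
    (hij : i < j) :
    cechSign K U i * cechSign K (U.erase i) j = -(cechSign K U j * cechSign K (U.erase j) i) := by
  have h1 : (U.erase j).filter (fun k => k < i) = U.filter (fun k => k < i) := by
    ext k
    simp only [Finset.mem_filter, Finset.mem_erase]
    constructor
    · rintro ⟨⟨-, h⟩, h'⟩; exact ⟨h, h'⟩
    · rintro ⟨h, h'⟩; exact ⟨⟨(h'.trans hij).ne, h⟩, h'⟩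
  have h2 : (U.erase i).filter (fun k => k < j) = (U.filter (fun k => k < j)).erase i := by
    ext k
    simp only [Finset.mem_filter, Finset.mem_erase, and_assoc]
  have h3 : i ∈ U.filter (fun k => k < j) := by simp [hi, hij]
  have h4 := Finset.card_erase_add_one h3
  unfold cechSign
  rw [h1, h2, ← h4, pow_succ]
  ring

theorem cechDifferential_cechDifferential {p : ℕ} (c : CechModule K n M p) :
    cechDifferential K n M (p + 1) (cechDifferential K n M p c) = 0 := by
  funext U
  rw [cechDifferential_apply, Pi.zero_apply]
  have h : ∀ i ∈ U.1, cechSign K U.1 i •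
      cechValue (cechDifferential K n M p c) U.1 (U.1.erase i) =
      ∑ j ∈ U.1.erase i, (cechSign K U.1 i * cechSign K (U.1.erase i) j) •
        cechValue c U.1 ((U.1.erase i).erase j) := by
    intro i hi
    rw [cechValue_cechDifferential c (Finset.erase_subset _ _)
      (by rw [Finset.card_erase_of_mem hi, U.2, Nat.add_sub_cancel]), Finset.smul_sum]
    exact Finset.sum_congr rfl fun j _ => by rw [mul_smul]
  rw [Finset.sum_congr rfl h, Finset.sum_sigma']
  -- The terms of `(i, j)` and `(j, i)` cancel.
  refine Finset.sum_involution (fun x _ => ⟨x.2, x.1⟩) ?_ ?_ ?_ ?_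
  · rintro ⟨i, j⟩ hx
    simp only [Finset.mem_sigma, Finset.mem_erase] at hx
    obtain ⟨hi, hji, hj⟩ := hx
    rw [Finset.erase_right_comm (a := j) (b := i), ← add_smul]
    rcases lt_or_gt_of_ne hji with h | h
    · rw [cechSign_mul_cechSign_erase hj h]; simp
    · rw [cechSign_mul_cechSign_erase hi h]; simp
  · rintro ⟨i, j⟩ hx _ he
    simp only [Finset.mem_sigma, Finset.mem_erase] at hx
    simp only [Sigma.mk.injEq] at he
    exact hx.2.1 he.1
  · rintro ⟨i, j⟩ hx
    simp only [Finset.mem_sigma, Finset.mem_erase] at hx ⊢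
    exact ⟨hx.2.2, hx.2.1.symm, hx.1⟩
  · rintro ⟨i, j⟩ hx
    rfl

/-- The map of Čech cochains induced by a linear map. -/
def cechMap (f : M →ₗ[MvPolynomial (Fin (n + 1)) K] N) (p : ℕ) :
    CechModule K n M p →ₗ[MvPolynomial (Fin (n + 1)) K] CechModule K n N p :=
  LinearMap.pi fun S => (IsLocalizedModule.map (monomialsIn K n S.1)
    (LocalizedModule.mkLinearMap _ M) (LocalizedModule.mkLinearMap _ N) f).comp
      (LinearMap.proj S)

theorem cechMap_apply (f : M →ₗ[MvPolynomial (Fin (n + 1)) K] N) {p : ℕ}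
    (c : CechModule K n M p) (S : {S : Finset (Fin (n + 1)) // S.card = p}) :
    cechMap f p c S = IsLocalizedModule.map (monomialsIn K n S.1)
      (LocalizedModule.mkLinearMap _ M) (LocalizedModule.mkLinearMap _ N) f (c S) := rfl

theorem map_liftOfLE (f : M →ₗ[MvPolynomial (Fin (n + 1)) K] N) {S T : Finset (Fin (n + 1))}
    (h : S ⊆ T) (y : LocalizedModule (monomialsIn K n S) M) :
    IsLocalizedModule.map (monomialsIn K n T)
      (LocalizedModule.mkLinearMap _ M) (LocalizedModule.mkLinearMap _ N) f
      (LocalizedModule.liftOfLE (M := M) (monomialsIn K n S) (monomialsIn K n T)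
        (monomialsIn_mono K h) y) =
    LocalizedModule.liftOfLE (M := N) (monomialsIn K n S) (monomialsIn K n T)
        (monomialsIn_mono K h) (IsLocalizedModule.map (monomialsIn K n S)
      (LocalizedModule.mkLinearMap _ M) (LocalizedModule.mkLinearMap _ N) f y) := by
  induction y using LocalizedModule.induction_on with
  | h m s =>
    rw [liftOfLE_mk h, IsLocalizedModule.map_LocalizedModules,
      IsLocalizedModule.map_LocalizedModules, liftOfLE_mk h]

theorem map_cechValue (f : M →ₗ[MvPolynomial (Fin (n + 1)) K] N) {p : ℕ}
    (c : CechModule K n M p) (U S : Finset (Fin (n + 1))) :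
    IsLocalizedModule.map (monomialsIn K n U)
      (LocalizedModule.mkLinearMap _ M) (LocalizedModule.mkLinearMap _ N) f (cechValue c U S) =
    cechValue (cechMap f p c) U S := by
  unfold cechValue
  split_ifs with h
  · rw [map_liftOfLE f h.1, cechMap_apply]
  · rw [map_zero]

theorem cechMap_cechDifferential (f : M →ₗ[MvPolynomial (Fin (n + 1)) K] N) {p : ℕ}
    (c : CechModule K n M p) :
    cechMap f (p + 1) (cechDifferential K n M p c) =
      cechDifferential K n N p (cechMap f p c) := by
  funext T
  rw [cechMap_apply, cechDifferential_apply, cechDifferential_apply, map_sum]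
  exact Finset.sum_congr rfl fun i _ => by rw [map_smul, map_cechValue]

theorem cechMap_injective {f : M →ₗ[MvPolynomial (Fin (n + 1)) K] N}
    (hf : Function.Injective f) (p : ℕ) : Function.Injective (cechMap f p) := by
  intro c c' h
  funext S
  exact IsLocalizedModule.map_injective (monomialsIn K n S.1) (LocalizedModule.mkLinearMap _ M)
    (LocalizedModule.mkLinearMap _ N) f hf (congrFun h S)

theorem cechMap_surjective {f : M →ₗ[MvPolynomial (Fin (n + 1)) K] N}
    (hf : Function.Surjective f) (p : ℕ) : Function.Surjective (cechMap f p) := by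
  intro c
  choose b hb using fun S : {S : Finset (Fin (n + 1)) // S.card = p} =>
    IsLocalizedModule.map_surjective (monomialsIn K n S.1)
      (LocalizedModule.mkLinearMap (monomialsIn K n S.1) M)
      (LocalizedModule.mkLinearMap (monomialsIn K n S.1) N) f hf (c S)
  exact ⟨b, funext hb⟩

theorem cechMap_exact {f : M →ₗ[MvPolynomial (Fin (n + 1)) K] N}
    {g : N →ₗ[MvPolynomial (Fin (n + 1)) K] P}
    (h : Function.Exact f g) (p : ℕ) : Function.Exact (cechMap f p) (cechMap g p) := by
  have hS := fun S : {S : Finset (Fin (n + 1)) // S.card = p} =>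
    IsLocalizedModule.map_exact (monomialsIn K n S.1)
      (LocalizedModule.mkLinearMap (monomialsIn K n S.1) M)
      (LocalizedModule.mkLinearMap (monomialsIn K n S.1) N)
      (LocalizedModule.mkLinearMap (monomialsIn K n S.1) P) f g h
  intro b
  constructor
  · intro hb
    choose a ha using fun S => (hS S (b S)).1 (congrFun hb S)
    exact ⟨a, funext ha⟩
  · rintro ⟨a, rfl⟩
    funext S
    exact (hS S _).2 ⟨a S, rfl⟩

/-! ### Vanishing of local cohomology in low degrees -/

variable (K n M) in
/-- `H^p_𝔪(M) = 0`: every Čech cocycle is a coboundary. -/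
def CechAcyclic (p : ℕ) : Prop :=
  ∀ c : CechModule K n M p, cechDifferential K n M p c = 0 → c ∈ cechBoundaries K n M p

theorem cechDifferential_of_mem_cechBoundaries {p : ℕ} {c : CechModule K n M p}
    (hc : c ∈ cechBoundaries K n M p) : cechDifferential K n M p c = 0 := by
  cases p with
  | zero => rw [(Submodule.mem_bot _).1 hc, map_zero]
  | succ p =>
    obtain ⟨b, rfl⟩ := hc
    exact cechDifferential_cechDifferential b

theorem cechMap_mem_cechBoundaries (f : M →ₗ[MvPolynomial (Fin (n + 1)) K] N) {p : ℕ}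
    {c : CechModule K n M p} (hc : c ∈ cechBoundaries K n M p) :
    cechMap f p c ∈ cechBoundaries K n N p := by
  cases p with
  | zero => rw [(Submodule.mem_bot _).1 hc, map_zero]; exact Submodule.zero_mem _
  | succ p =>
    obtain ⟨b, rfl⟩ := hc
    exact ⟨cechMap f p b, (cechMap_cechDifferential f b).symm⟩

theorem exists_mem_cechBoundaries_of_surjective {g : N →ₗ[MvPolynomial (Fin (n + 1)) K] P}
    (hg : Function.Surjective g) {p : ℕ} {c : CechModule K n P p}
    (hc : c ∈ cechBoundaries K n P p) : ∃ b ∈ cechBoundaries K n N p, cechMap g p b = c := by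
  cases p with
  | zero => exact ⟨0, Submodule.zero_mem _, by rw [(Submodule.mem_bot _).1 hc, map_zero]⟩
  | succ p =>
    obtain ⟨y, rfl⟩ := hc
    obtain ⟨b, rfl⟩ := cechMap_surjective hg p y
    exact ⟨_, ⟨b, rfl⟩, cechMap_cechDifferential g b⟩

section ShortExact

variable {f : M →ₗ[MvPolynomial (Fin (n + 1)) K] N} {g : N →ₗ[MvPolynomial (Fin (n + 1)) K] P}

/-- The part `H^p(N) → H^p(P) → H^{p+1}(M)` of the long exact sequence. -/
theorem CechAcyclic.of_shortExact (hf : Function.Injective f) (hg : Function.Surjective g)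
    (hfg : Function.Exact f g) {p : ℕ} (hN : CechAcyclic K n N p)
    (hM : CechAcyclic K n M (p + 1)) : CechAcyclic K n P p := by
  intro c hc
  obtain ⟨b, rfl⟩ := cechMap_surjective hg p c
  rw [← cechMap_cechDifferential] at hc
  obtain ⟨a, ha⟩ := (cechMap_exact hfg (p + 1) _).1 hc
  have ha0 : cechDifferential K n M (p + 1) a = 0 := by
    apply cechMap_injective hf
    rw [cechMap_cechDifferential, ha, cechDifferential_cechDifferential, map_zero]
  obtain ⟨a', ha'⟩ := hM a ha0
  have hb : cechDifferential K n N p (b - cechMap f p a') = 0 := by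
    rw [map_sub, ← cechMap_cechDifferential, ha', ha, sub_self]
  have := cechMap_mem_cechBoundaries g (hN _ hb)
  rwa [map_sub, (cechMap_exact hfg p).apply_apply_eq_zero, sub_zero] at this

/-- The injectivity of `H^p(M) → H^p(N)` when `H^{p-1}(P) = 0`. -/
theorem mem_cechBoundaries_of_cechMap_mem (hf : Function.Injective f)
    (hg : Function.Surjective g) (hfg : Function.Exact f g) {p : ℕ}
    (hP : ∀ q, q + 1 = p → CechAcyclic K n P q) {c : CechModule K n M p}
    (hc : cechMap f p c ∈ cechBoundaries K n N p) : c ∈ cechBoundaries K n M p := by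
  cases p with
  | zero =>
    have := (Submodule.mem_bot _).1 hc
    rw [cechMap_injective hf 0 (this.trans (map_zero _).symm)]
    exact Submodule.zero_mem _
  | succ p =>
    obtain ⟨b, hb⟩ := hc
    have hgb : cechDifferential K n P p (cechMap g p b) = 0 := by
      rw [← cechMap_cechDifferential, hb, (cechMap_exact hfg _).apply_apply_eq_zero]
    obtain ⟨b', hb', hgb'⟩ := exists_mem_cechBoundaries_of_surjective hg (hP p rfl _ hgb)
    obtain ⟨a, ha⟩ := (cechMap_exact hfg p (b - b')).1 (by rw [map_sub, hgb', sub_self])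
    refine ⟨a, cechMap_injective hf _ ?_⟩
    rw [cechMap_cechDifferential, ha, map_sub, cechDifferential_of_mem_cechBoundaries hb',
      sub_zero, hb]

/-- The surjectivity of `H^p(M) → H^p(N)` when `H^p(P) = 0`. -/
theorem exists_cocycle_cechMap_sub_mem (hf : Function.Injective f)
    (hg : Function.Surjective g) (hfg : Function.Exact f g) {p : ℕ}
    (hP : CechAcyclic K n P p) {c : CechModule K n N p}
    (hc : cechDifferential K n N p c = 0) :
    ∃ a, cechDifferential K n M p a = 0 ∧ c - cechMap f p a ∈ cechBoundaries K n N p := by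
  have hgc : cechDifferential K n P p (cechMap g p c) = 0 := by
    rw [← cechMap_cechDifferential, hc, map_zero]
  obtain ⟨b, hb, hgb⟩ := exists_mem_cechBoundaries_of_surjective hg (hP _ hgc)
  obtain ⟨a, ha⟩ := (cechMap_exact hfg p (c - b)).1 (by rw [map_sub, hgb, sub_self])
  refine ⟨a, cechMap_injective hf _ ?_, ?_⟩
  · rw [cechMap_cechDifferential, ha, map_sub, hc, cechDifferential_of_mem_cechBoundaries hb,
      map_zero, sub_zero]
  · rwa [ha, sub_sub_cancel]

end ShortExact

end Cech

section Vanishing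

variable {K : Type*} [Field K] {n : ℕ}
  {M : Type*} [AddCommGroup M] [Module (MvPolynomial (Fin (n + 1)) K) M]
  {P : Type*} [AddCommGroup P] [Module (MvPolynomial (Fin (n + 1)) K) P]

theorem exists_eq_mul_X_pow_of_mem_monomialsIn_insert {S : Finset (Fin (n + 1))} {k : Fin (n + 1)}
    {t : MvPolynomial (Fin (n + 1)) K} (ht : t ∈ monomialsIn K n (insert k S)) :
    ∃ u ∈ monomialsIn K n S, ∃ a : ℕ, t = X k ^ a * u := by
  induction ht using Submonoid.closure_induction with
  | mem x hx =>
    obtain ⟨i, hi, rfl⟩ := hx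
    rcases Finset.mem_insert.1 (Finset.mem_coe.1 hi) with rfl | hi
    · exact ⟨1, one_mem _, 1, by simp⟩
    · exact ⟨X i, Submonoid.subset_closure ⟨i, hi, rfl⟩, 0, by simp⟩
  | one => exact ⟨1, one_mem _, 0, by simp⟩
  | mul x y _ _ hx hy =>
    obtain ⟨u, hu, a, rfl⟩ := hx
    obtain ⟨v, hv, b, rfl⟩ := hy
    exact ⟨u * v, mul_mem hu hv, a + b, by ring⟩

theorem liftOfLE_insert_injective {k : Fin (n + 1)}
    (hk : ∀ m : M, (X k : MvPolynomial (Fin (n + 1)) K) • m = 0 → m = 0)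
    (S : Finset (Fin (n + 1))) {y : LocalizedModule (monomialsIn K n S) M}
    (hy : LocalizedModule.liftOfLE (M := M) (monomialsIn K n S) (monomialsIn K n (insert k S))
      (monomialsIn_mono K (Finset.subset_insert k S)) y = 0) : y = 0 := by
  have hpow : ∀ (a : ℕ) (m : M), (X k : MvPolynomial (Fin (n + 1)) K) ^ a • m = 0 → m = 0 := by
    intro a
    induction a with
    | zero => intro m hm; simpa using hm
    | succ a ih => intro m hm; exact ih m (hk _ (by rwa [smul_smul, ← pow_succ']))
  induction y using LocalizedModule.induction_on with
  | h m s =>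
    rw [liftOfLE_mk (Finset.subset_insert k S), ← LocalizedModule.zero_mk 1,
      LocalizedModule.mk_eq] at hy
    obtain ⟨⟨t, ht⟩, h⟩ := hy
    obtain ⟨u, hu, a, rfl⟩ := exists_eq_mul_X_pow_of_mem_monomialsIn_insert ht
    rw [← LocalizedModule.zero_mk 1, LocalizedModule.mk_eq]
    refine ⟨⟨u, hu⟩, ?_⟩
    simp only [Submonoid.smul_def, one_smul, smul_zero] at h ⊢
    exact hpow a _ (by rwa [smul_smul])

theorem exists_liftOfLE_eq_X_pow_smul {k : Fin (n + 1)} (S : Finset (Fin (n + 1)))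
    (y : LocalizedModule (monomialsIn K n (insert k S)) M) :
    ∃ a : ℕ, ∀ b, a ≤ b → ∃ z, LocalizedModule.liftOfLE (M := M) (monomialsIn K n S)
      (monomialsIn K n (insert k S)) (monomialsIn_mono K (Finset.subset_insert k S)) z =
        (X k : MvPolynomial (Fin (n + 1)) K) ^ b • y := by
  induction y using LocalizedModule.induction_on with
  | h m s =>
    obtain ⟨s, hs⟩ := s
    obtain ⟨u, hu, a, rfl⟩ := exists_eq_mul_X_pow_of_mem_monomialsIn_insert hs
    refine ⟨a, fun b hb => ⟨LocalizedModule.mk ((X k : MvPolynomial (Fin (n + 1)) K) ^ (b - a) • m)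
      ⟨u, hu⟩, ?_⟩⟩
    rw [liftOfLE_mk (Finset.subset_insert k S), LocalizedModule.smul'_mk, LocalizedModule.mk_eq]
    refine ⟨1, ?_⟩
    simp only [Submonoid.smul_def, one_smul, smul_smul]
    congr 1
    conv_rhs => rw [← Nat.sub_add_cancel hb, pow_add]
    ring

theorem cechSign_mul_self (T : Finset (Fin (n + 1))) (i : Fin (n + 1)) :
    cechSign K T i * cechSign K T i = 1 := by
  rw [cechSign, ← pow_add, ← two_mul, pow_mul]
  simp

/-- A cocycle that vanishes at all index sets containing `k` is determined by restriction to the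
localization at `x_k`, hence is `0` if `x_k` is regular on `M`. -/
theorem eq_zero_of_cocycle_of_vanish {k : Fin (n + 1)}
    (hk : ∀ m : M, (X k : MvPolynomial (Fin (n + 1)) K) • m = 0 → m = 0)
    {p : ℕ} {c : CechModule K n M p} (hc : cechDifferential K n M p c = 0)
    (hv : ∀ S, k ∈ S.1 → c S = 0) : c = 0 := by
  funext S
  by_cases hkS : k ∈ S.1
  · exact hv S hkS
  have hcard : (insert k S.1).card = p + 1 := by rw [Finset.card_insert_of_notMem hkS, S.2]
  have h := congrFun hc ⟨insert k S.1, hcard⟩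
  rw [cechDifferential_apply, Finset.sum_eq_single k] at h
  · have h' : cechValue c (insert k S.1) S.1 = 0 := by
      have := congrArg (fun y => cechSign K (insert k S.1) k • y) h
      simpa only [smul_smul, cechSign_mul_self, one_smul, Finset.erase_insert hkS,
        Pi.zero_apply, smul_zero] using this
    rw [cechValue, dif_pos ⟨Finset.subset_insert k S.1, S.2⟩] at h'
    exact liftOfLE_insert_injective hk S.1 h'
  · intro i _ hik
    have hmem : k ∈ (insert k S.1).erase i :=
      Finset.mem_erase.2 ⟨hik.symm, Finset.mem_insert_self _ _⟩
    unfold cechValue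
    split_ifs with h2
    · rw [hv _ hmem, map_zero, smul_zero]
    · rw [smul_zero]
  · intro hn
    exact absurd (Finset.mem_insert_self k S.1) hn

/-- The contracting homotopy of the Čech complex of a module on which `x_k` is invertible: up to a
power of `x_k`, a cochain agrees with a coboundary at all index sets containing `k`. -/
theorem exists_cechDifferential_eq_X_pow_smul (k : Fin (n + 1)) {p : ℕ}
    (c : CechModule K n M (p + 1)) :
    ∃ (a : ℕ) (b : CechModule K n M p), ∀ T : {S : Finset (Fin (n + 1)) // S.card = p + 1},
      k ∈ T.1 → cechDifferential K n M p b T = (X k : MvPolynomial (Fin (n + 1)) K) ^ a • c T := by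
  have h : ∀ S : {S : Finset (Fin (n + 1)) // S.card = p}, ∃ a : ℕ, ∀ b, a ≤ b →
      ∃ z : LocalizedModule (monomialsIn K n S.1) M, (k ∈ S.1 → z = 0) ∧ (k ∉ S.1 →
        ∀ h : (insert k S.1).card = p + 1, LocalizedModule.liftOfLE (M := M) (monomialsIn K n S.1)
      (monomialsIn K n (insert k S.1)) (monomialsIn_mono K (Finset.subset_insert k S.1)) z =
        (X k : MvPolynomial (Fin (n + 1)) K) ^ b • cechSign K (insert k S.1) k •
          c ⟨insert k S.1, h⟩) := by
    intro S
    by_cases hkS : k ∈ S.1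
    · exact ⟨0, fun b _ => ⟨0, fun _ => rfl, fun h => absurd hkS h⟩⟩
    · have hcard : (insert k S.1).card = p + 1 := by rw [Finset.card_insert_of_notMem hkS, S.2]
      obtain ⟨a, ha⟩ := exists_liftOfLE_eq_X_pow_smul S.1
        (cechSign K (insert k S.1) k • c ⟨insert k S.1, hcard⟩)
      refine ⟨a, fun b hb => ?_⟩
      obtain ⟨z, hz⟩ := ha b hb
      exact ⟨z, fun h => absurd h hkS, fun _ _ => hz⟩
  choose a ha using h
  choose b hb hb' using fun S => ha S (∑ S, a S)
    (Finset.single_le_sum (f := a) (fun _ _ => Nat.zero_le _) (Finset.mem_univ S))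
  refine ⟨∑ S, a S, b, fun T hT => ?_⟩
  rw [cechDifferential_apply, Finset.sum_eq_single_of_mem k hT]
  · obtain ⟨T, hTc⟩ := T
    obtain ⟨S, hkS, rfl⟩ : ∃ S, k ∉ S ∧ T = insert k S :=
      ⟨T.erase k, Finset.notMem_erase k T, (Finset.insert_erase hT).symm⟩
    have hS : S.card = p := by
      rw [Finset.card_insert_of_notMem hkS] at hTc
      omega
    simp only [Finset.erase_insert hkS]
    rw [cechValue, dif_pos ⟨Finset.subset_insert k S, hS⟩, hb' ⟨S, hS⟩ hkS hTc, smul_smul,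
      smul_smul, mul_right_comm, cechSign_mul_self, one_mul]
  · intro i _ hik
    have hmem : k ∈ T.1.erase i := Finset.mem_erase.2 ⟨hik.symm, hT⟩
    unfold cechValue
    split_ifs with h2
    · rw [hb _ hmem, map_zero, smul_zero]
    · rw [smul_zero]

/-- Local cohomology is `x_k`-torsion. -/
theorem exists_X_pow_smul_mem_cechBoundaries {k : Fin (n + 1)}
    (hk : ∀ m : M, (X k : MvPolynomial (Fin (n + 1)) K) • m = 0 → m = 0)
    {p : ℕ} {c : CechModule K n M p} (hc : cechDifferential K n M p c = 0) :
    ∃ a : ℕ, (X k : MvPolynomial (Fin (n + 1)) K) ^ a • c ∈ cechBoundaries K n M p := by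
  cases p with
  | zero =>
    refine ⟨0, ?_⟩
    rw [eq_zero_of_cocycle_of_vanish hk hc, smul_zero]
    · exact Submodule.zero_mem _
    · rintro ⟨S, hS⟩ hkS
      obtain rfl := Finset.card_eq_zero.1 hS
      exact absurd hkS (Finset.notMem_empty k)
  | succ p =>
    obtain ⟨a, b, hb⟩ := exists_cechDifferential_eq_X_pow_smul k c
    refine ⟨a, b, ?_⟩
    rw [← sub_eq_zero]
    refine eq_zero_of_cocycle_of_vanish hk ?_ fun T hT => ?_
    · rw [map_sub, cechDifferential_cechDifferential, map_smul, hc, smul_zero, sub_zero]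
    · rw [Pi.sub_apply, Pi.smul_apply, hb T hT, sub_self]

theorem cechMap_lsmul (r : MvPolynomial (Fin (n + 1)) K) {p : ℕ} (c : CechModule K n M p) :
    cechMap (LinearMap.lsmul (MvPolynomial (Fin (n + 1)) K) M r) p c = r • c := by
  funext S
  have h : LinearMap.lsmul (MvPolynomial (Fin (n + 1)) K) M r = r • LinearMap.id := rfl
  rw [cechMap_apply, h, map_smul, IsLocalizedModule.map_id]
  rfl

/-- If `x_k` is regular on `M` and `H^{p-1}(M/x_kM) = 0`, then `H^p(M) = 0`: multiplication by
`x_k` on it is injective as well as locally nilpotent. -/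
theorem CechAcyclic.of_X_regular {k : Fin (n + 1)}
    (hk : ∀ m : M, (X k : MvPolynomial (Fin (n + 1)) K) • m = 0 → m = 0)
    {g : M →ₗ[MvPolynomial (Fin (n + 1)) K] P} (hg : Function.Surjective g)
    (hkg : Function.Exact (LinearMap.lsmul (MvPolynomial (Fin (n + 1)) K) M (X k)) g) {p : ℕ}
    (hP : ∀ q, q + 1 = p → CechAcyclic K n P q) : CechAcyclic K n M p := by
  intro c hc
  have hinj : Function.Injective (LinearMap.lsmul (MvPolynomial (Fin (n + 1)) K) M (X k)) :=
    (injective_iff_map_eq_zero _).2 hk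
  obtain ⟨a, ha⟩ := exists_X_pow_smul_mem_cechBoundaries hk hc
  induction a with
  | zero => simpa using ha
  | succ a ih =>
    refine ih (mem_cechBoundaries_of_cechMap_mem hinj hg hkg hP ?_)
    rwa [cechMap_lsmul, smul_smul, ← pow_succ']

/-- Multiplication by `G` as a map `R/I → R/J`. -/
def quotientMul (I J : Ideal (MvPolynomial (Fin (n + 1)) K)) (G : MvPolynomial (Fin (n + 1)) K)
    (h : ∀ x ∈ I, G * x ∈ J) :
    (MvPolynomial (Fin (n + 1)) K ⧸ I) →ₗ[MvPolynomial (Fin (n + 1)) K]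
      (MvPolynomial (Fin (n + 1)) K ⧸ J) :=
  Submodule.mapQ I J (LinearMap.lsmul _ _ G) h

section quotientMul

variable {I J : Ideal (MvPolynomial (Fin (n + 1)) K)} {G : MvPolynomial (Fin (n + 1)) K}

theorem quotientMul_mk (h : ∀ x ∈ I, G * x ∈ J) (x : MvPolynomial (Fin (n + 1)) K) :
    quotientMul I J G h (Ideal.Quotient.mk I x) = Ideal.Quotient.mk J (G * x) := rfl

theorem quotientMul_injective (h : ∀ x ∈ I, G * x ∈ J) (h' : ∀ x, G * x ∈ J → x ∈ I) :
    Function.Injective (quotientMul I J G h) := by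
  rw [injective_iff_map_eq_zero]
  intro x hx
  obtain ⟨x, rfl⟩ := Ideal.Quotient.mk_surjective x
  rw [quotientMul_mk, Ideal.Quotient.eq_zero_iff_mem] at hx
  exact Ideal.Quotient.eq_zero_iff_mem.2 (h' x hx)

theorem quotientMul_exact (h : ∀ x ∈ I, G * x ∈ J) :
    Function.Exact (quotientMul I J G h)
      (Submodule.factor (le_sup_left : J ≤ J ⊔ Ideal.span {G})) := by
  intro y
  obtain ⟨y, rfl⟩ := Ideal.Quotient.mk_surjective y
  have hy : Submodule.factor (le_sup_left : J ≤ J ⊔ Ideal.span {G}) (Ideal.Quotient.mk J y) =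
    Ideal.Quotient.mk (J ⊔ Ideal.span {G}) y := rfl
  rw [hy, Ideal.Quotient.eq_zero_iff_mem]
  constructor
  · intro hy
    obtain ⟨z, hz, w, hw, rfl⟩ := Submodule.mem_sup.1 hy
    obtain ⟨a, rfl⟩ := Ideal.mem_span_singleton'.1 hw
    refine ⟨Ideal.Quotient.mk I a, ?_⟩
    rw [quotientMul_mk, Ideal.Quotient.eq]
    have : G * a - (z + a * G) = -z := by ring
    rw [this]
    exact neg_mem hz
  · rintro ⟨x, hx⟩
    obtain ⟨x, rfl⟩ := Ideal.Quotient.mk_surjective x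
    rw [quotientMul_mk, Ideal.Quotient.eq] at hx
    have : y = -(G * x - y) + x * G := by ring
    rw [this]
    exact add_mem (Ideal.mem_sup_left (neg_mem hx))
      (Ideal.mem_sup_right (Ideal.mem_span_singleton'.2 ⟨x, rfl⟩))

theorem CechAcyclic.quotient_sup_span (hG : ∀ x, G * x ∈ I → x ∈ I) {p : ℕ}
    (h : CechAcyclic K n (MvPolynomial (Fin (n + 1)) K ⧸ I) p)
    (h' : CechAcyclic K n (MvPolynomial (Fin (n + 1)) K ⧸ I) (p + 1)) :
    CechAcyclic K n (MvPolynomial (Fin (n + 1)) K ⧸ (I ⊔ Ideal.span {G})) p :=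
  CechAcyclic.of_shortExact (quotientMul_injective (fun _ hx => I.mul_mem_left G hx) hG)
    (Submodule.factor_surjective _) (quotientMul_exact _) h h'

end quotientMul

theorem mem_span_X_image_of_X_mul_mem {s : Finset (Fin (n + 1))} {k : Fin (n + 1)} (hk : k ∉ s)
    {f : MvPolynomial (Fin (n + 1)) K}
    (hf : X k * f ∈ Ideal.span (X '' (s : Set (Fin (n + 1))) :
      Set (MvPolynomial (Fin (n + 1)) K))) :
    f ∈ Ideal.span (X '' (s : Set (Fin (n + 1))) : Set (MvPolynomial (Fin (n + 1)) K)) := by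
  rw [mem_ideal_span_X_image] at hf ⊢
  intro m hm
  obtain ⟨i, hi, hne⟩ := hf (Finsupp.single k 1 + m) (by
    rw [mem_support_iff, coeff_X_mul]
    exact mem_support_iff.1 hm)
  refine ⟨i, hi, ?_⟩
  have hki : k ≠ i := fun h => hk (h ▸ hi)
  rwa [Finsupp.add_apply, Finsupp.single_eq_of_ne hki.symm, zero_add] at hne

variable (K n) in
/-- The quotient of `R` by all but `t` of the variables has no local cohomology in degrees below
`t`. The case `t = n + 1` is that of `R` itself. -/
theorem cechAcyclic_quotient_span_X_image (t : ℕ) :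
    ∀ s : Finset (Fin (n + 1)), s.card + t = n + 1 → ∀ p < t,
      CechAcyclic K n (MvPolynomial (Fin (n + 1)) K ⧸
        Ideal.span (X '' (s : Set (Fin (n + 1))) : Set (MvPolynomial (Fin (n + 1)) K))) p := by
  induction t with
  | zero => intro s _ p hp; omega
  | succ t ih =>
    intro s hs p hp
    obtain ⟨k, hk⟩ : ∃ k, k ∉ s := by
      by_contra! h
      have : s = Finset.univ := Finset.eq_univ_iff_forall.2 h
      rw [this, Finset.card_univ, Fintype.card_fin] at hs
      omega
    have hI : Ideal.span (X '' ((insert k s : Finset (Fin (n + 1))) : Set (Fin (n + 1))) :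
        Set (MvPolynomial (Fin (n + 1)) K)) =
        Ideal.span (X '' (s : Set (Fin (n + 1))) : Set (MvPolynomial (Fin (n + 1)) K)) ⊔
          Ideal.span {X k} := by
      rw [← Ideal.span_union, Finset.coe_insert, Set.image_insert_eq, Set.union_comm]
      rfl
    have hex := quotientMul_exact (I := Ideal.span (X '' (s : Set (Fin (n + 1))) :
      Set (MvPolynomial (Fin (n + 1)) K))) (G := X k) fun _ hx => Ideal.mul_mem_left _ (X k) hx
    refine CechAcyclic.of_X_regular (k := k) ?_ (Submodule.factor_surjective _)
      (g := Submodule.factor (le_sup_left (b := Ideal.span {X k}))) ?_ fun q hq => ?_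
    · intro m hm
      obtain ⟨m, rfl⟩ := Ideal.Quotient.mk_surjective m
      exact Ideal.Quotient.eq_zero_iff_mem.2
        (mem_span_X_image_of_X_mul_mem hk (Ideal.Quotient.eq_zero_iff_mem.1 hm))
    · have he : LinearMap.lsmul (MvPolynomial (Fin (n + 1)) K) (MvPolynomial (Fin (n + 1)) K ⧸
          Ideal.span (X '' (s : Set (Fin (n + 1))) : Set (MvPolynomial (Fin (n + 1)) K))) (X k) =
          quotientMul _ _ (X k) fun _ hx => Ideal.mul_mem_left _ (X k) hx := by
        ext
        rfl
      rw [he]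
      exact hex
    · have := ih (insert k s) (by rw [Finset.card_insert_of_notMem hk]; omega) q (by omega)
      rwa [hI] at this

/-- The complete intersection `R/(F, G)` has no local cohomology in degrees at most `n - 2`. -/
theorem cechAcyclic_quotient_span_sup_span {F G : MvPolynomial (Fin (n + 1)) K} (hF : F ≠ 0)
    (hFG : IsRelPrime F G) {p : ℕ} (hp : p + 2 ≤ n) :
    CechAcyclic K n (MvPolynomial (Fin (n + 1)) K ⧸ (Ideal.span {F} ⊔ Ideal.span {G})) p := by
  have h0 : ∀ q < n + 1, CechAcyclic K n (MvPolynomial (Fin (n + 1)) K ⧸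
      (⊥ : Ideal (MvPolynomial (Fin (n + 1)) K))) q := by
    intro q hq
    have := cechAcyclic_quotient_span_X_image K n (n + 1) ∅ (by simp) q hq
    rwa [Finset.coe_empty, Set.image_empty, Ideal.span_empty] at this
  have h1 : ∀ q < n, CechAcyclic K n (MvPolynomial (Fin (n + 1)) K ⧸ Ideal.span {F}) q := by
    intro q hq
    have := CechAcyclic.quotient_sup_span (I := ⊥) (G := F)
      (fun x hx => by simpa [hF] using hx) (h0 q (by omega)) (h0 (q + 1) (by omega))
    rwa [bot_sup_eq] at this
  refine CechAcyclic.quotient_sup_span (fun x hx => ?_) (h1 p (by omega)) (h1 (p + 1) (by omega))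
  rw [Ideal.mem_span_singleton] at hx ⊢
  exact hFG.dvd_of_dvd_mul_left hx

end Vanishing

/-! ### Graded local cohomology through projections onto graded components -/

section Grading

variable {K : Type*} [Field K] {n : ℕ}

theorem homogeneousComponent_mem_of_isHomogeneous {I : Ideal (MvPolynomial (Fin (n + 1)) K)}
    (hI : I.IsHomogeneous (homogeneousSubmodule (Fin (n + 1)) K)) (j : ℕ)
    {x : MvPolynomial (Fin (n + 1)) K} (hx : x ∈ I) : homogeneousComponent j x ∈ I := by
  have := hI j hx
  rwa [show ((DirectSum.decompose (homogeneousSubmodule (Fin (n + 1)) K) x) j :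
    MvPolynomial (Fin (n + 1)) K) = homogeneousComponent j x from
      decomposition.decompose'_apply x j] at this

variable (K n) in
/-- The projection of the polynomial ring onto its component of degree `j`, which is `0` for
negative `j`. -/
def polynomialProj (j : ℤ) : MvPolynomial (Fin (n + 1)) K →+ MvPolynomial (Fin (n + 1)) K :=
  if 0 ≤ j then (homogeneousComponent j.toNat).toAddMonoidHom else 0

theorem polynomialProj_natCast (j : ℕ) (x : MvPolynomial (Fin (n + 1)) K) :
    polynomialProj K n j x = homogeneousComponent j x := by
  simp [polynomialProj]

theorem polynomialProj_of_isHomogeneous {x : MvPolynomial (Fin (n + 1)) K} {i : ℕ}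
    (hx : x.IsHomogeneous i) (j : ℤ) : polynomialProj K n j x = if j = i then x else 0 := by
  unfold polynomialProj
  split_ifs with h h' h'
  · have : j.toNat = i := by omega
    simp [this, homogeneousComponent_of_mem hx]
  · have : j.toNat ≠ i := by omega
    simp [this, homogeneousComponent_of_mem hx]
  · omega
  · rfl

theorem polynomialProj_mul {r : MvPolynomial (Fin (n + 1)) K} {e : ℕ} (hr : r.IsHomogeneous e)
    (j : ℤ) (x : MvPolynomial (Fin (n + 1)) K) :
    polynomialProj K n (j + e) (r * x) = r * polynomialProj K n j x := by
  rw [← sum_homogeneousComponent x, Finset.mul_sum, map_sum, map_sum, Finset.mul_sum]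
  refine Finset.sum_congr rfl fun i _ => ?_
  rw [polynomialProj_of_isHomogeneous (homogeneousComponent_isHomogeneous i x),
    polynomialProj_of_isHomogeneous (hr.mul (homogeneousComponent_isHomogeneous i x))]
  have : j + (e : ℤ) = ((e + i : ℕ) : ℤ) ↔ j = i := by push_cast; omega
  simp only [this, mul_ite, mul_zero]

theorem polynomialProj_mem {I : Ideal (MvPolynomial (Fin (n + 1)) K)}
    (hI : I.IsHomogeneous (homogeneousSubmodule (Fin (n + 1)) K)) (j : ℤ)
    {x : MvPolynomial (Fin (n + 1)) K} (hx : x ∈ I) : polynomialProj K n j x ∈ I := by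
  unfold polynomialProj
  split_ifs
  · exact homogeneousComponent_mem_of_isHomogeneous hI _ hx
  · exact I.zero_mem

/-- The projection of `R/I` onto its component of degree `j`. -/
def quotientProj (I : Ideal (MvPolynomial (Fin (n + 1)) K))
    (hI : I.IsHomogeneous (homogeneousSubmodule (Fin (n + 1)) K)) (j : ℤ) :
    (MvPolynomial (Fin (n + 1)) K ⧸ I) →+ (MvPolynomial (Fin (n + 1)) K ⧸ I) :=
  QuotientAddGroup.lift I.toAddSubgroup
    ((Ideal.Quotient.mk I).toAddMonoidHom.comp (polynomialProj K n j))
    fun _ hx => Ideal.Quotient.eq_zero_iff_mem.2 (polynomialProj_mem hI j hx)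

theorem quotientProj_mk (I : Ideal (MvPolynomial (Fin (n + 1)) K))
    (hI : I.IsHomogeneous (homogeneousSubmodule (Fin (n + 1)) K)) (j : ℤ)
    (x : MvPolynomial (Fin (n + 1)) K) :
    quotientProj I hI j (Ideal.Quotient.mk I x) = Ideal.Quotient.mk I (polynomialProj K n j x) :=
  rfl

variable {M : Type*} [AddCommGroup M] [Module (MvPolynomial (Fin (n + 1)) K) M]
  {N : Type*} [AddCommGroup N] [Module (MvPolynomial (Fin (n + 1)) K) N]

/-- A family of additive maps of a module that shifts degrees under multiplication by forms in the
way the projections onto graded components do. -/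
def IsDegreeProj (pr : ℤ → M →+ M) : Prop :=
  ∀ ⦃r : MvPolynomial (Fin (n + 1)) K⦄ ⦃e : ℕ⦄, r.IsHomogeneous e → ∀ (j : ℤ) (m : M),
    pr (j + e) (r • m) = r • pr j m

theorem isDegreeProj_quotientProj (I : Ideal (MvPolynomial (Fin (n + 1)) K))
    (hI : I.IsHomogeneous (homogeneousSubmodule (Fin (n + 1)) K)) :
    IsDegreeProj (K := K) (n := n) (quotientProj I hI) := by
  intro r e hr j m
  obtain ⟨m, rfl⟩ := Ideal.Quotient.mk_surjective m
  have : ∀ x, r • Ideal.Quotient.mk I x = Ideal.Quotient.mk I (r * x) := fun x => rfl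
  rw [this, quotientProj_mk, polynomialProj_mul hr, quotientProj_mk, this]

theorem exists_isHomogeneous_of_mem_monomialsIn {S : Finset (Fin (n + 1))}
    {s : MvPolynomial (Fin (n + 1)) K} (hs : s ∈ monomialsIn K n S) :
    s ≠ 0 ∧ s.IsHomogeneous s.totalDegree := by
  suffices h : s ≠ 0 ∧ ∃ e, s.IsHomogeneous e by
    obtain ⟨h0, e, he⟩ := h
    exact ⟨h0, by rwa [he.totalDegree h0]⟩
  induction hs using Submonoid.closure_induction with
  | mem x hx =>
    obtain ⟨i, -, rfl⟩ := hx
    exact ⟨X_ne_zero i, 1, isHomogeneous_X K i⟩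
  | one => exact ⟨one_ne_zero, 0, isHomogeneous_one _ _⟩
  | mul x y _ _ hx hy =>
    obtain ⟨hx0, e, he⟩ := hx
    obtain ⟨hy0, f, hf⟩ := hy
    exact ⟨mul_ne_zero hx0 hy0, e + f, he.mul hf⟩

/-- The projection of the localization `M_{x_S}` onto its component of degree `d`. -/
def localizedProj {pr : ℤ → M →+ M} (hpr : IsDegreeProj (K := K) (n := n) pr)
    (S : Finset (Fin (n + 1))) (d : ℤ) (y : LocalizedModule (monomialsIn K n S) M) :
    LocalizedModule (monomialsIn K n S) M :=
  LocalizedModule.liftOn y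
    (fun x => LocalizedModule.mk (pr (d + x.2.1.totalDegree) x.1) x.2) (by
      rintro ⟨m, s, hs⟩ ⟨m', s', hs'⟩ ⟨⟨u, hu⟩, h⟩
      refine LocalizedModule.mk_eq.2 ⟨⟨u, hu⟩, ?_⟩
      have h1 := (exists_isHomogeneous_of_mem_monomialsIn hs).2
      have h2 := (exists_isHomogeneous_of_mem_monomialsIn hs').2
      have h3 := (exists_isHomogeneous_of_mem_monomialsIn hu).2
      simp only [Submonoid.smul_def] at h ⊢
      rw [← hpr h2, ← hpr h1, ← hpr h3, ← hpr h3, add_right_comm d (s'.totalDegree : ℤ)]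
      exact congrArg _ h)

section

variable {pr : ℤ → M →+ M} (hpr : IsDegreeProj (K := K) (n := n) pr)
  {pr' : ℤ → N →+ N} (hpr' : IsDegreeProj (K := K) (n := n) pr')

theorem localizedProj_mk {S : Finset (Fin (n + 1))} (d : ℤ) (m : M) (s : monomialsIn K n S)
    {e : ℕ} (he : s.1.IsHomogeneous e) :
    localizedProj hpr S d (LocalizedModule.mk m s) = LocalizedModule.mk (pr (d + e) m) s := by
  rw [localizedProj, LocalizedModule.liftOn_mk,
    he.totalDegree (exists_isHomogeneous_of_mem_monomialsIn s.2).1]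

theorem localizedProj_add {S : Finset (Fin (n + 1))} (d : ℤ)
    (y z : LocalizedModule (monomialsIn K n S) M) :
    localizedProj hpr S d (y + z) = localizedProj hpr S d y + localizedProj hpr S d z := by
  induction y, z using LocalizedModule.induction_on₂ with
  | h m m' s s' =>
    have h1 := (exists_isHomogeneous_of_mem_monomialsIn s.2).2
    have h2 := (exists_isHomogeneous_of_mem_monomialsIn s'.2).2
    rw [LocalizedModule.mk_add_mk, localizedProj_mk hpr d _ s h1, localizedProj_mk hpr d _ s' h2,
      localizedProj_mk hpr d _ (s * s') (h1.mul h2), LocalizedModule.mk_add_mk, map_add]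
    simp only [Submonoid.smul_def]
    rw [← hpr h1, ← hpr h2]
    push_cast
    congr 3
    · ring_nf
    · ring_nf

theorem localizedProj_smul {S : Finset (Fin (n + 1))} {r : MvPolynomial (Fin (n + 1)) K} {e : ℕ}
    (hr : r.IsHomogeneous e) (d : ℤ) (y : LocalizedModule (monomialsIn K n S) M) :
    localizedProj hpr S (d + e) (r • y) = r • localizedProj hpr S d y := by
  induction y using LocalizedModule.induction_on with
  | h m s =>
    have h1 := (exists_isHomogeneous_of_mem_monomialsIn s.2).2
    rw [LocalizedModule.smul'_mk, localizedProj_mk hpr _ _ s h1, localizedProj_mk hpr _ _ s h1,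
      LocalizedModule.smul'_mk, ← hpr hr, add_right_comm]

theorem localizedProj_zero {S : Finset (Fin (n + 1))} (d : ℤ) :
    localizedProj hpr S d (0 : LocalizedModule (monomialsIn K n S) M) = 0 := by
  have := localizedProj_add hpr d (0 : LocalizedModule (monomialsIn K n S) M) 0
  rwa [add_zero, left_eq_add] at this

theorem localizedProj_liftOfLE {S T : Finset (Fin (n + 1))} (h : S ⊆ T) (d : ℤ)
    (y : LocalizedModule (monomialsIn K n S) M) :
    localizedProj hpr T d (LocalizedModule.liftOfLE (M := M) (monomialsIn K n S)
      (monomialsIn K n T) (monomialsIn_mono K h) y) =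
    LocalizedModule.liftOfLE (M := M) (monomialsIn K n S)
      (monomialsIn K n T) (monomialsIn_mono K h) (localizedProj hpr S d y) := by
  induction y using LocalizedModule.induction_on with
  | h m s =>
    have h1 := (exists_isHomogeneous_of_mem_monomialsIn s.2).2
    rw [liftOfLE_mk h, localizedProj_mk hpr d _ s h1, liftOfLE_mk h,
      localizedProj_mk hpr d m ⟨s.1, monomialsIn_mono K h s.2⟩ h1]

theorem localizedProj_map {f : M →ₗ[MvPolynomial (Fin (n + 1)) K] N} {b : ℤ}
    (hf : ∀ j m, f (pr j m) = pr' (j + b) (f m)) {S : Finset (Fin (n + 1))} (d : ℤ)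
    (y : LocalizedModule (monomialsIn K n S) M) :
    IsLocalizedModule.map (monomialsIn K n S)
      (LocalizedModule.mkLinearMap _ M) (LocalizedModule.mkLinearMap _ N) f
      (localizedProj hpr S d y) = localizedProj hpr' S (d + b)
      (IsLocalizedModule.map (monomialsIn K n S)
      (LocalizedModule.mkLinearMap _ M) (LocalizedModule.mkLinearMap _ N) f y) := by
  induction y using LocalizedModule.induction_on with
  | h m s =>
    have h1 := (exists_isHomogeneous_of_mem_monomialsIn s.2).2
    rw [localizedProj_mk hpr d _ s h1, IsLocalizedModule.map_LocalizedModules,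
      IsLocalizedModule.map_LocalizedModules, localizedProj_mk hpr' _ _ s h1, hf, add_right_comm]

/-- The projection of the Čech cochains onto their component of degree `d`. -/
def cechProj {p : ℕ} (d : ℤ) (c : CechModule K n M p) : CechModule K n M p :=
  fun S => localizedProj hpr S.1 d (c S)

theorem cechProj_sub {p : ℕ} (d : ℤ) (c c' : CechModule K n M p) :
    cechProj hpr d (c - c') = cechProj hpr d c - cechProj hpr d c' := by
  funext S
  have h := localizedProj_add hpr d (c S - c' S) (c' S)
  rw [sub_add_cancel] at h
  simp only [cechProj, Pi.sub_apply, h, add_sub_cancel_right]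

theorem cechProj_zero {p : ℕ} (d : ℤ) : cechProj hpr d (0 : CechModule K n M p) = 0 :=
  funext fun _ => localizedProj_zero hpr d

theorem cechProj_cechDifferential {p : ℕ} (d : ℤ) (c : CechModule K n M p) :
    cechProj hpr d (cechDifferential K n M p c) =
      cechDifferential K n M p (cechProj hpr d c) := by
  funext T
  rw [cechProj, cechDifferential_apply, cechDifferential_apply]
  have hsum := map_sum (AddMonoidHom.mk' (localizedProj hpr T.1 d) (localizedProj_add hpr d))
    (fun i => cechSign K T.1 i • cechValue c T.1 (T.1.erase i)) T.1
  refine hsum.trans (Finset.sum_congr rfl fun i _ => ?_)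
  have hsign : (cechSign K T.1 i).IsHomogeneous 0 := by
    unfold cechSign
    simpa using (isHomogeneous_one (Fin (n + 1)) K).neg.pow (T.1.filter (fun j => j < i)).card
  have := localizedProj_smul hpr hsign d (cechValue c T.1 (T.1.erase i))
  rw [Nat.cast_zero, add_zero] at this
  refine this.trans (congrArg _ ?_)
  unfold cechValue
  split_ifs with h
  · exact localizedProj_liftOfLE hpr h.1 d _
  · exact localizedProj_zero hpr d

theorem cechProj_mem_cechBoundaries {p : ℕ} (d : ℤ) {c : CechModule K n M p}
    (hc : c ∈ cechBoundaries K n M p) : cechProj hpr d c ∈ cechBoundaries K n M p := by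
  cases p with
  | zero =>
    rw [(Submodule.mem_bot _).1 hc, cechProj_zero]
    exact Submodule.zero_mem _
  | succ p =>
    obtain ⟨b, rfl⟩ := hc
    exact ⟨cechProj hpr d b, (cechProj_cechDifferential hpr d b).symm⟩

theorem cechProj_cocycle {p : ℕ} (d : ℤ) {c : CechModule K n M p}
    (hc : cechDifferential K n M p c = 0) :
    cechDifferential K n M p (cechProj hpr d c) = 0 := by
  rw [← cechProj_cechDifferential, hc, cechProj_zero]

theorem cechMap_cechProj {f : M →ₗ[MvPolynomial (Fin (n + 1)) K] N} {b : ℤ}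
    (hf : ∀ j m, f (pr j m) = pr' (j + b) (f m)) {p : ℕ} (d : ℤ) (c : CechModule K n M p) :
    cechMap f p (cechProj hpr d c) = cechProj hpr' (d + b) (cechMap f p c) :=
  funext fun S => localizedProj_map hpr hpr' hf d (c S)

end

/-- The class of a Čech cocycle. -/
def cechClass {p : ℕ} (c : CechModule K n M p) (hc : cechDifferential K n M p c = 0) :
    LocalCohomology K n M p :=
  Submodule.Quotient.mk ⟨c, hc⟩

theorem exists_cechClass_eq {p : ℕ} (x : LocalCohomology K n M p) :
    ∃ c hc, cechClass c hc = x := by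
  obtain ⟨⟨c, hc⟩, rfl⟩ := Submodule.Quotient.mk_surjective _ x
  exact ⟨c, hc, rfl⟩

theorem cechClass_eq_iff {p : ℕ} {c c' : CechModule K n M p}
    {hc : cechDifferential K n M p c = 0} {hc' : cechDifferential K n M p c' = 0} :
    cechClass c hc = cechClass c' hc' ↔ c - c' ∈ cechBoundaries K n M p := by
  rw [cechClass, cechClass, Submodule.Quotient.eq]
  rfl

section Pieces

variable {I : Ideal (MvPolynomial (Fin (n + 1)) K)}
  (hI : I.IsHomogeneous (homogeneousSubmodule (Fin (n + 1)) K))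

theorem quotientProj_of_mem_quotientPiece {j : ℕ} {m : MvPolynomial (Fin (n + 1)) K ⧸ I}
    (hm : m ∈ quotientPiece I j) : quotientProj I hI j m = m := by
  obtain ⟨x, hx, rfl⟩ := hm
  change Ideal.Quotient.mk I (polynomialProj K n j x) = Ideal.Quotient.mk I x
  rw [polynomialProj_of_isHomogeneous hx, if_pos rfl]

theorem quotientProj_mem_quotientPiece (j : ℕ) (m : MvPolynomial (Fin (n + 1)) K ⧸ I) :
    quotientProj I hI j m ∈ quotientPiece I j := by
  obtain ⟨x, rfl⟩ := Ideal.Quotient.mk_surjective m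
  rw [quotientProj_mk, polynomialProj_natCast]
  exact ⟨_, homogeneousComponent_isHomogeneous j x, rfl⟩

theorem quotientProj_of_neg {j : ℤ} (hj : j < 0) (m : MvPolynomial (Fin (n + 1)) K ⧸ I) :
    quotientProj I hI j m = 0 := by
  obtain ⟨x, rfl⟩ := Ideal.Quotient.mk_surjective m
  rw [quotientProj_mk, polynomialProj, if_neg (by omega), AddMonoidHom.zero_apply, map_zero]

theorem localizedProj_of_mem_localizedPiece {S : Finset (Fin (n + 1))} {d : ℤ}
    {y : LocalizedModule (monomialsIn K n S) (MvPolynomial (Fin (n + 1)) K ⧸ I)}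
    (hy : y ∈ localizedPiece (quotientPiece I) S d) :
    localizedProj (isDegreeProj_quotientProj I hI) S d y = y := by
  obtain ⟨m, s, j, e, hm, hs, hd, rfl⟩ := hy
  rw [localizedProj_mk _ d m s hs, show d + (e : ℤ) = (j : ℤ) by omega,
    quotientProj_of_mem_quotientPiece hI hm]

theorem localizedProj_mem_localizedPiece {S : Finset (Fin (n + 1))} {d : ℤ}
    (hS : S.Nonempty ∨ 0 ≤ d)
    (y : LocalizedModule (monomialsIn K n S) (MvPolynomial (Fin (n + 1)) K ⧸ I)) :
    localizedProj (isDegreeProj_quotientProj I hI) S d y ∈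
      localizedPiece (quotientPiece I) S d := by
  induction y using LocalizedModule.induction_on with
  | h m s =>
    have h1 := (exists_isHomogeneous_of_mem_monomialsIn s.2).2
    rw [localizedProj_mk _ d m s h1]
    by_cases hd : 0 ≤ d + s.1.totalDegree
    · obtain ⟨j, hj⟩ := Int.eq_ofNat_of_zero_le hd
      refine ⟨_, s, j, _, ?_, h1, by omega, rfl⟩
      rw [hj]
      exact quotientProj_mem_quotientPiece hI j m
    · -- The component is zero; it is a fraction `0 / s` of degree `d` for `s` of large degree.
      rw [quotientProj_of_neg hI (not_le.1 hd), LocalizedModule.zero_mk]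
      obtain ⟨i, hi⟩ : S.Nonempty := hS.resolve_right fun h => hd (by positivity)
      have hX : X i ∈ monomialsIn K n S := Submonoid.subset_closure ⟨i, hi, rfl⟩
      refine ⟨0, ⟨X i ^ (-d).toNat, pow_mem hX _⟩, 0,
        (-d).toNat, Submodule.zero_mem _, ?_, by omega, (LocalizedModule.zero_mk _).symm⟩
      simpa using (isHomogeneous_X K i).pow (-d).toNat

/-- The component of degree `d` of `H^p_𝔪(R/I)` is the fixed set of the projection. The case
`p = 0`, `d < 0` is excluded: no fraction with denominator `1` has negative degree, not even `0`, so
that `localCohomologyPiece` is empty instead of `{0}` there. -/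
theorem cechClass_mem_localCohomologyPiece_iff {p : ℕ} {d : ℤ} (hpd : p ≠ 0 ∨ 0 ≤ d)
    {c : CechModule K n (MvPolynomial (Fin (n + 1)) K ⧸ I) p}
    (hc : cechDifferential K n _ p c = 0) :
    cechClass c hc ∈ localCohomologyPiece (quotientPiece I) p d ↔
      cechClass (cechProj (isDegreeProj_quotientProj I hI) d c)
        (cechProj_cocycle _ d hc) = cechClass c hc := by
  constructor
  · rintro ⟨⟨c', hc'⟩, hd, h⟩
    have h' : cechClass c' hc' = cechClass c hc := h
    have hfix : cechProj (isDegreeProj_quotientProj I hI) d c' = c' :=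
      funext fun S => localizedProj_of_mem_localizedPiece hI (hd S)
    have := cechProj_mem_cechBoundaries (isDegreeProj_quotientProj I hI) d
      (cechClass_eq_iff.1 h')
    rw [cechProj_sub, hfix] at this
    rw [← h', eq_comm]
    exact cechClass_eq_iff.2 this
  · intro h
    refine ⟨⟨_, cechProj_cocycle (isDegreeProj_quotientProj I hI) d hc⟩, fun S => ?_, h⟩
    refine localizedProj_mem_localizedPiece hI ?_ _
    refine hpd.imp_left fun hp => Finset.card_pos.1 ?_
    rw [S.2]
    omega

theorem notMem_localCohomologyPiece_zero {d : ℤ} (hd : d < 0)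
    (x : LocalCohomology K n (MvPolynomial (Fin (n + 1)) K ⧸ I) 0) :
    x ∉ localCohomologyPiece (quotientPiece I) 0 d := by
  rintro ⟨c, hc, -⟩
  obtain ⟨m, s, j, e, -, hs, hje, -⟩ := hc ⟨∅, rfl⟩
  have hs1 : s.1 = 1 := by
    have := s.2
    simpa [monomialsIn] using this
  rw [hs1] at hs
  have := hs.inj_right (isHomogeneous_one _ _) one_ne_zero
  omega

end Pieces

/-! ### Local cohomology of basic double links -/

/-- There is a linear isomorphism `H^p_𝔪(R/I) ≅ H^p_𝔪(R/J)` that raises degrees by `b`. -/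
def ShiftedCohomologyIso {I J : Ideal (MvPolynomial (Fin (n + 1)) K)}
    (hI : I.IsHomogeneous (homogeneousSubmodule (Fin (n + 1)) K))
    (hJ : J.IsHomogeneous (homogeneousSubmodule (Fin (n + 1)) K)) (b : ℤ) (p : ℕ) : Prop :=
  ∃ e : LocalCohomology K n (MvPolynomial (Fin (n + 1)) K ⧸ I) p
      ≃ₗ[MvPolynomial (Fin (n + 1)) K] LocalCohomology K n (MvPolynomial (Fin (n + 1)) K ⧸ J) p,
    ∀ d c hc c' hc', e (cechClass c hc) = cechClass c' hc' →
      e (cechClass (cechProj (isDegreeProj_quotientProj I hI) d c) (cechProj_cocycle _ d hc)) =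
        cechClass (cechProj (isDegreeProj_quotientProj J hJ) (d + b) c')
          (cechProj_cocycle _ (d + b) hc')

section Shifted

variable {I J L : Ideal (MvPolynomial (Fin (n + 1)) K)}
  {hI : I.IsHomogeneous (homogeneousSubmodule (Fin (n + 1)) K)}
  {hJ : J.IsHomogeneous (homogeneousSubmodule (Fin (n + 1)) K)}
  {hL : L.IsHomogeneous (homogeneousSubmodule (Fin (n + 1)) K)} {b b' : ℤ} {p : ℕ}

theorem ShiftedCohomologyIso.refl : ShiftedCohomologyIso hI hI 0 p := by
  refine ⟨LinearEquiv.refl _ _, fun d c hc c' hc' h => ?_⟩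
  have := cechProj_mem_cechBoundaries (isDegreeProj_quotientProj I hI) d (cechClass_eq_iff.1 h)
  rw [cechProj_sub] at this
  simp only [add_zero]
  exact cechClass_eq_iff.2 this

theorem ShiftedCohomologyIso.symm (h : ShiftedCohomologyIso hI hJ b p) :
    ShiftedCohomologyIso hJ hI (-b) p := by
  obtain ⟨e, he⟩ := h
  refine ⟨e.symm, fun d c hc c' hc' h => ?_⟩
  rw [LinearEquiv.symm_apply_eq] at h ⊢
  have := he (d + -b) c' hc' c hc h.symm
  simp only [neg_add_cancel_right] at this
  exact this.symm

theorem ShiftedCohomologyIso.trans (h : ShiftedCohomologyIso hI hJ b p)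
    (h' : ShiftedCohomologyIso hJ hL b' p) : ShiftedCohomologyIso hI hL (b + b') p := by
  obtain ⟨e, he⟩ := h
  obtain ⟨e', he'⟩ := h'
  refine ⟨e.trans e', fun d c hc c' hc' h => ?_⟩
  obtain ⟨c₁, hc₁, h₁⟩ := exists_cechClass_eq (e (cechClass c hc))
  rw [LinearEquiv.trans_apply] at h ⊢
  rw [← h₁] at h
  rw [he d c hc c₁ hc₁ h₁.symm, he' _ _ _ _ hc' h]
  simp only [add_assoc]

theorem ShiftedCohomologyIso.gradedLocalCohomologyIso (h : ShiftedCohomologyIso hI hJ 0 p) :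
    GradedLocalCohomologyIso I J p := by
  obtain ⟨e, he⟩ := h
  refine ⟨e, fun d x => ?_⟩
  by_cases hpd : p ≠ 0 ∨ 0 ≤ d
  · obtain ⟨c, hc, rfl⟩ := exists_cechClass_eq x
    obtain ⟨c', hc', h⟩ := exists_cechClass_eq (e (cechClass c hc))
    have h' := he d c hc c' hc' h.symm
    simp only [add_zero] at h'
    rw [← h, cechClass_mem_localCohomologyPiece_iff hI hpd,
      cechClass_mem_localCohomologyPiece_iff hJ hpd, ← h', h, e.injective.eq_iff]
  · push Not at hpd
    obtain ⟨rfl, hd⟩ := hpd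
    exact iff_of_false (notMem_localCohomologyPiece_zero hd x)
      (notMem_localCohomologyPiece_zero hd (e x))

/-- A short exact sequence `0 → (R/I)(-b) → R/J → P → 0` with `H^{p-1}(P) = H^p(P) = 0` gives
`H^p(R/I)(-b) ≅ H^p(R/J)`. -/
theorem ShiftedCohomologyIso.of_quotientMul {G : MvPolynomial (Fin (n + 1)) K} {b : ℕ}
    (hG : G.IsHomogeneous b) (h : ∀ x ∈ I, G * x ∈ J) (h' : ∀ x, G * x ∈ J → x ∈ I)
    (hp : ∀ q, q = p ∨ q + 1 = p →
      CechAcyclic K n (MvPolynomial (Fin (n + 1)) K ⧸ (J ⊔ Ideal.span {G})) q) :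
    ShiftedCohomologyIso hI hJ b p := by
  have hinj := quotientMul_injective h h'
  have hsurj := Submodule.factor_surjective (le_sup_left : J ≤ J ⊔ Ideal.span {G})
  have hex := quotientMul_exact h
  have hmem : ∀ c ∈ LinearMap.ker (cechDifferential K n (MvPolynomial (Fin (n + 1)) K ⧸ I) p),
      cechMap (quotientMul I J G h) p c ∈
        LinearMap.ker (cechDifferential K n (MvPolynomial (Fin (n + 1)) K ⧸ J) p) := by
    intro c hc
    rw [LinearMap.mem_ker] at hc ⊢
    rw [← cechMap_cechDifferential, hc, map_zero]
  let φ : LocalCohomology K n (MvPolynomial (Fin (n + 1)) K ⧸ I) p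
      →ₗ[MvPolynomial (Fin (n + 1)) K]
        LocalCohomology K n (MvPolynomial (Fin (n + 1)) K ⧸ J) p :=
    Submodule.mapQ _ _ ((cechMap (quotientMul I J G h) p).restrict hmem)
      fun c hc => cechMap_mem_cechBoundaries _ hc
  have hcoc : ∀ c, cechDifferential K n (MvPolynomial (Fin (n + 1)) K ⧸ I) p c = 0 →
      cechDifferential K n (MvPolynomial (Fin (n + 1)) K ⧸ J) p
        (cechMap (quotientMul I J G h) p c) = 0 := hmem
  have hφ : ∀ c hc, φ (cechClass c hc) =
      cechClass (cechMap (quotientMul I J G h) p c) (hcoc c hc) := fun c hc => rfl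
  have hbij : Function.Bijective φ := by
    constructor
    · intro x y hxy
      obtain ⟨c, hc, rfl⟩ := exists_cechClass_eq x
      obtain ⟨c', hc', rfl⟩ := exists_cechClass_eq y
      rw [hφ, hφ, cechClass_eq_iff, ← map_sub] at hxy
      exact cechClass_eq_iff.2 (mem_cechBoundaries_of_cechMap_mem hinj hsurj hex
        (fun q hq => hp q (Or.inr hq)) hxy)
    · intro y
      obtain ⟨c, hc, rfl⟩ := exists_cechClass_eq y
      obtain ⟨a, ha, hca⟩ := exists_cocycle_cechMap_sub_mem hinj hsurj hex (hp p (Or.inl rfl)) hc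
      exact ⟨cechClass a ha, by rw [hφ, eq_comm]; exact cechClass_eq_iff.2 hca⟩
  refine ⟨LinearEquiv.ofBijective φ hbij, fun d c hc c' hc' hcc' => ?_⟩
  rw [LinearEquiv.ofBijective_apply, hφ] at hcc' ⊢
  have hproj : ∀ j m, quotientMul I J G h (quotientProj I hI j m) =
      quotientProj J hJ (j + b) (quotientMul I J G h m) := by
    intro j m
    obtain ⟨m, rfl⟩ := Ideal.Quotient.mk_surjective m
    rw [quotientProj_mk, quotientMul_mk, quotientMul_mk, quotientProj_mk, polynomialProj_mul hG]
  have := cechProj_mem_cechBoundaries (isDegreeProj_quotientProj J hJ) (d + b)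
    (cechClass_eq_iff.1 hcc')
  rw [cechProj_sub, ← cechMap_cechProj (isDegreeProj_quotientProj I hI) _ hproj] at this
  exact cechClass_eq_iff.2 this

end Shifted

end Grading

/-! ### Hilbert functions of ideals and of basic double links -/

section Hilbert

variable {K : Type*} [Field K] {n : ℕ}

instance finiteDimensional_homogeneousSubmodule (j : ℕ) :
    Module.Finite K (homogeneousSubmodule (Fin (n + 1)) K j) :=
  Module.Finite.iff_fg.2 (homogeneousSubmodule_fg _ K j)

variable (K n) in
theorem finrank_homogeneousSubmodule (j : ℕ) :
    Module.finrank K (homogeneousSubmodule (Fin (n + 1)) K j) = (n + j).choose n := by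
  classical
  rw [homogeneousSubmodule_eq_finsupp_supported]
  have hset : {d : Fin (n + 1) →₀ ℕ | d.degree = j} =
      ((Finset.univ.finsuppAntidiag j : Finset (Fin (n + 1) →₀ ℕ)) : Set (Fin (n + 1) →₀ ℕ)) := by
    ext d
    simp [Finset.mem_finsuppAntidiag, Finsupp.degree_eq_sum]
  rw [(AddMonoidAlgebra.supportedEquivFinsupp _).finrank_eq, hset]
  have := Module.finrank_finsupp_self (R := K)
    (ι := ((Finset.univ.finsuppAntidiag j : Finset (Fin (n + 1) →₀ ℕ)) : Set (Fin (n + 1) →₀ ℕ)))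
  rw [this]
  simp only [Finset.coe_sort_coe, Fintype.card_coe]
  rw [Finset.card_finsuppAntidiag_nat_eq_choose, Finset.card_univ, Fintype.card_fin]
  rw [show n + 1 + j - 1 = n + j by omega, Nat.choose_symm_add]

/-- The component `[I]_j` of an ideal `I`. -/
def idealPiece (I : Ideal (MvPolynomial (Fin (n + 1)) K)) (j : ℕ) :
    Submodule K (MvPolynomial (Fin (n + 1)) K) :=
  homogeneousSubmodule (Fin (n + 1)) K j ⊓ I.restrictScalars K

instance finiteDimensional_idealPiece (I : Ideal (MvPolynomial (Fin (n + 1)) K)) (j : ℕ) :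
    Module.Finite K (idealPiece I j) :=
  Submodule.finiteDimensional_of_le inf_le_left

theorem mem_idealPiece {I : Ideal (MvPolynomial (Fin (n + 1)) K)} {j : ℕ}
    {x : MvPolynomial (Fin (n + 1)) K} : x ∈ idealPiece I j ↔ x.IsHomogeneous j ∧ x ∈ I := Iff.rfl

theorem finrank_map_add_finrank_inf_ker {V W : Type*} [AddCommGroup V] [Module K V]
    [AddCommGroup W] [Module K W] (f : V →ₗ[K] W) (U : Submodule K V) [Module.Finite K U] :
    Module.finrank K (U.map f) + Module.finrank K (U ⊓ LinearMap.ker f : Submodule K V) =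
      Module.finrank K U := by
  have h := LinearMap.finrank_range_add_finrank_ker (f.domRestrict U)
  rw [LinearMap.range_domRestrict] at h
  rw [← h, LinearMap.ker_domRestrict, ← Submodule.finrank_map_subtype_eq U,
    Submodule.map_comap_subtype]

theorem hilbertFunction_add_finrank_idealPiece (I : Ideal (MvPolynomial (Fin (n + 1)) K)) (j : ℕ) :
    hilbertFunction I j + Module.finrank K (idealPiece I j) = (n + j).choose n := by
  rw [← finrank_homogeneousSubmodule K n j, ← finrank_map_add_finrank_inf_ker
    (Ideal.Quotient.mkₐ K I).toLinearMap (homogeneousSubmodule (Fin (n + 1)) K j)]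
  have : LinearMap.ker (Ideal.Quotient.mkₐ K I).toLinearMap = I.restrictScalars K := by
    ext x
    exact Ideal.Quotient.eq_zero_iff_mem
  rw [this]
  rfl

theorem idealPiece_mono {I J : Ideal (MvPolynomial (Fin (n + 1)) K)} (h : I ≤ J) (j : ℕ) :
    idealPiece I j ≤ idealPiece J j := fun _ hx => ⟨hx.1, h hx.2⟩

theorem hilbertFunction_anti {I J : Ideal (MvPolynomial (Fin (n + 1)) K)} (h : I ≤ J) (j : ℕ) :
    hilbertFunction J j ≤ hilbertFunction I j := by
  have h1 := hilbertFunction_add_finrank_idealPiece I j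
  have h2 := hilbertFunction_add_finrank_idealPiece J j
  have h3 := Submodule.finrank_mono (idealPiece_mono h j)
  omega

theorem finrank_idealPiece_top (j : ℕ) : Module.finrank K
    (idealPiece (⊤ : Ideal (MvPolynomial (Fin (n + 1)) K)) j) = (n + j).choose n := by
  have h : idealPiece (⊤ : Ideal (MvPolynomial (Fin (n + 1)) K)) j =
      homogeneousSubmodule (Fin (n + 1)) K j := by
    ext x
    simp [mem_idealPiece]
  rw [← finrank_homogeneousSubmodule K n j, h]

theorem homogeneousComponent_of_isHomogeneous {x : MvPolynomial (Fin (n + 1)) K} {j : ℕ}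
    (hx : x.IsHomogeneous j) : homogeneousComponent j x = x := by
  rw [homogeneousComponent_of_mem hx, if_pos rfl]

theorem idealPiece_sup {I J : Ideal (MvPolynomial (Fin (n + 1)) K)}
    (hI : I.IsHomogeneous (homogeneousSubmodule (Fin (n + 1)) K))
    (hJ : J.IsHomogeneous (homogeneousSubmodule (Fin (n + 1)) K)) (j : ℕ) :
    idealPiece (I ⊔ J) j = idealPiece I j ⊔ idealPiece J j := by
  refine le_antisymm ?_ (sup_le (idealPiece_mono le_sup_left j) (idealPiece_mono le_sup_right j))
  rintro x ⟨hx, hxIJ⟩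
  obtain ⟨y, hy, z, hz, rfl⟩ := Submodule.mem_sup.1 hxIJ
  rw [← homogeneousComponent_of_isHomogeneous hx, map_add]
  exact Submodule.add_mem_sup
    ⟨homogeneousComponent_isHomogeneous j y, homogeneousComponent_mem_of_isHomogeneous hI j hy⟩
    ⟨homogeneousComponent_isHomogeneous j z, homogeneousComponent_mem_of_isHomogeneous hJ j hz⟩

theorem finrank_idealPiece_span_mul {I : Ideal (MvPolynomial (Fin (n + 1)) K)}
    (hI : I.IsHomogeneous (homogeneousSubmodule (Fin (n + 1)) K))
    {G : MvPolynomial (Fin (n + 1)) K} (hG0 : G ≠ 0) {b : ℕ} (hG : G.IsHomogeneous b) (j : ℕ) :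
    Module.finrank K (idealPiece (Ideal.span {G} * I) j) =
      if b ≤ j then Module.finrank K (idealPiece I (j - b)) else 0 := by
  have key : ∀ x ∈ idealPiece (Ideal.span {G} * I) j,
      ∃ y ∈ I, x = G * polynomialProj K n (j - b) y := by
    rintro x ⟨hx, hxI⟩
    obtain ⟨y, hy, rfl⟩ := Ideal.mem_span_singleton_mul.1 hxI
    refine ⟨y, hy, ?_⟩
    rw [← polynomialProj_mul hG, sub_add_cancel, polynomialProj_of_isHomogeneous hx, if_pos rfl]
  split_ifs with h
  · have : idealPiece (Ideal.span {G} * I) j =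
        (idealPiece I (j - b)).map (LinearMap.mulLeft K G) := by
      ext x
      constructor
      · intro hx
        obtain ⟨y, hy, rfl⟩ := key x hx
        rw [← Nat.cast_sub h, polynomialProj_natCast]
        exact ⟨_, ⟨homogeneousComponent_isHomogeneous _ y,
          homogeneousComponent_mem_of_isHomogeneous hI _ hy⟩, rfl⟩
      · rintro ⟨y, ⟨hy, hyI⟩, rfl⟩
        refine ⟨?_, Ideal.mul_mem_mul (Ideal.mem_span_singleton_self G) hyI⟩
        have := hG.mul hy
        rwa [Nat.add_sub_cancel' h] at this
    rw [this]
    exact (Submodule.equivMapOfInjective _ (mul_right_injective₀ hG0) _).finrank_eq.symm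
  · have : idealPiece (Ideal.span {G} * I) j = ⊥ := by
      rw [eq_bot_iff]
      intro x hx
      obtain ⟨y, hy, rfl⟩ := key x hx
      rw [polynomialProj, if_neg (by omega), AddMonoidHom.zero_apply, mul_zero]
      exact Submodule.zero_mem _
    rw [this, finrank_bot]

/-! ### Hilbert series -/

theorem mk_difference (f : ℕ → ℤ) :
    PowerSeries.mk (difference f) = (1 - PowerSeries.X) * PowerSeries.mk f := by
  ext j
  rw [sub_mul, one_mul, map_sub, PowerSeries.coeff_mk, PowerSeries.coeff_mk]
  cases j with
  | zero => simp [difference]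
  | succ j => rw [PowerSeries.coeff_succ_X_mul, PowerSeries.coeff_mk, difference]

theorem mk_difference_iterate (f : ℕ → ℤ) (m : ℕ) :
    PowerSeries.mk (difference^[m] f) = (1 - PowerSeries.X) ^ m * PowerSeries.mk f := by
  induction m with
  | zero => simp
  | succ m ih => rw [Function.iterate_succ_apply', mk_difference, ih, pow_succ']; ring

/-- The Hilbert series of `R/I`. -/
def hilbertSeries (I : Ideal (MvPolynomial (Fin (n + 1)) K)) : PowerSeries ℤ :=
  PowerSeries.mk fun j => (hilbertFunction I j : ℤ)

/-- The series `∑ dim [I]_j X^j` of an ideal `I`. -/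
def idealSeries (I : Ideal (MvPolynomial (Fin (n + 1)) K)) : PowerSeries ℤ :=
  PowerSeries.mk fun j => (Module.finrank K (idealPiece I j) : ℤ)

/-- The Hilbert series of the polynomial ring `R` itself. -/
def polynomialSeries (n : ℕ) : PowerSeries ℤ :=
  PowerSeries.mk fun j => ((n + j).choose n : ℤ)

theorem one_sub_pow_mul_polynomialSeries (n : ℕ) :
    (1 - PowerSeries.X) ^ (n + 1) * polynomialSeries n = 1 := by
  rw [mul_comm]
  exact PowerSeries.mk_add_choose_mul_one_sub_pow_eq_one ℤ n

theorem hilbertSeries_eq (I : Ideal (MvPolynomial (Fin (n + 1)) K)) :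
    hilbertSeries I = polynomialSeries n - idealSeries I := by
  ext j
  simp only [hilbertSeries, polynomialSeries, idealSeries, map_sub, PowerSeries.coeff_mk]
  rw [← hilbertFunction_add_finrank_idealPiece I j]
  push_cast
  ring

theorem idealSeries_top :
    idealSeries (⊤ : Ideal (MvPolynomial (Fin (n + 1)) K)) = polynomialSeries n := by
  ext j
  simp [idealSeries, polynomialSeries, finrank_idealPiece_top]

theorem idealSeries_span_mul {I : Ideal (MvPolynomial (Fin (n + 1)) K)}
    (hI : I.IsHomogeneous (homogeneousSubmodule (Fin (n + 1)) K))
    {G : MvPolynomial (Fin (n + 1)) K} (hG0 : G ≠ 0) {b : ℕ} (hG : G.IsHomogeneous b) :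
    idealSeries (Ideal.span {G} * I) = PowerSeries.X ^ b * idealSeries I := by
  ext j
  rw [PowerSeries.coeff_X_pow_mul', idealSeries, idealSeries, PowerSeries.coeff_mk,
    finrank_idealPiece_span_mul hI hG0 hG, PowerSeries.coeff_mk]
  split_ifs <;> simp

theorem idealSeries_sup_add_inf {I J : Ideal (MvPolynomial (Fin (n + 1)) K)}
    (hI : I.IsHomogeneous (homogeneousSubmodule (Fin (n + 1)) K))
    (hJ : J.IsHomogeneous (homogeneousSubmodule (Fin (n + 1)) K)) :
    idealSeries (I ⊔ J) + idealSeries (I ⊓ J) = idealSeries I + idealSeries J := by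
  ext j
  simp only [idealSeries, map_add, PowerSeries.coeff_mk]
  have h : idealPiece (I ⊓ J) j = idealPiece I j ⊓ idealPiece J j := by
    ext x
    simp only [mem_idealPiece, Submodule.mem_inf]
    tauto
  rw [idealPiece_sup hI hJ, h]
  exact_mod_cast Submodule.finrank_sup_add_finrank_inf_eq (idealPiece I j) (idealPiece J j)

theorem isHomogeneous_span_singleton {G : MvPolynomial (Fin (n + 1)) K} {b : ℕ}
    (hG : G.IsHomogeneous b) :
    (Ideal.span {G}).IsHomogeneous (homogeneousSubmodule (Fin (n + 1)) K) :=
  Ideal.homogeneous_span _ _ fun x hx => ⟨b, by rw [Set.mem_singleton_iff.1 hx]; exact hG⟩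

theorem isHomogeneous_span_mul {I : Ideal (MvPolynomial (Fin (n + 1)) K)}
    (hI : I.IsHomogeneous (homogeneousSubmodule (Fin (n + 1)) K))
    {G : MvPolynomial (Fin (n + 1)) K} {b : ℕ} (hG : G.IsHomogeneous b) :
    (Ideal.span {G} * I).IsHomogeneous (homogeneousSubmodule (Fin (n + 1)) K) :=
  (isHomogeneous_span_singleton hG).mul hI

/-- The Hilbert series of a basic double link `G · I + (F)`; for `I = R` this is that of a
complete intersection. -/
theorem hilbertSeries_basicDoubleLink {I : Ideal (MvPolynomial (Fin (n + 1)) K)}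
    (hI : I.IsHomogeneous (homogeneousSubmodule (Fin (n + 1)) K))
    {F G : MvPolynomial (Fin (n + 1)) K} {d b : ℕ} (hFI : F ∈ I) (hF0 : F ≠ 0)
    (hF : F.IsHomogeneous d) (hG0 : G ≠ 0) (hG : G.IsHomogeneous b) (hFG : IsRelPrime F G) :
    hilbertSeries (Ideal.span {G} * I ⊔ Ideal.span {F}) = PowerSeries.X ^ b * hilbertSeries I +
      (1 - PowerSeries.X ^ b) * (1 - PowerSeries.X ^ d) * polynomialSeries n := by
  have hinf : Ideal.span {G} * I ⊓ Ideal.span {F} = Ideal.span {G} * (Ideal.span {F} * ⊤) := by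
    refine le_antisymm ?_ (le_inf (Ideal.mul_mono_right ?_) ?_)
    · rintro x ⟨hx, hx'⟩
      obtain ⟨y, hy, rfl⟩ := Ideal.mem_span_singleton_mul.1 hx
      refine Ideal.mul_mem_mul (Ideal.mem_span_singleton_self G) ?_
      rw [Ideal.mul_top, Ideal.mem_span_singleton]
      exact hFG.dvd_of_dvd_mul_left (Ideal.mem_span_singleton.1 hx')
    · rw [Ideal.mul_top, Ideal.span_singleton_le_iff_mem]
      exact hFI
    · rw [Ideal.mul_top]
      exact Ideal.mul_le_right
  have htop : (⊤ : Ideal (MvPolynomial (Fin (n + 1)) K)).IsHomogeneous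
      (homogeneousSubmodule (Fin (n + 1)) K) := Ideal.IsHomogeneous.top _
  have h1 := idealSeries_sup_add_inf (isHomogeneous_span_mul hI hG)
    (isHomogeneous_span_singleton hF)
  have h2 := idealSeries_span_mul htop hF0 hF
  rw [hinf, idealSeries_span_mul (isHomogeneous_span_mul htop hF) hG0 hG, h2, idealSeries_top,
    idealSeries_span_mul hI hG0 hG] at h1
  rw [Ideal.mul_top, idealSeries_top] at h2
  rw [h2] at h1
  rw [hilbertSeries_eq, hilbertSeries_eq]
  linear_combination -h1

/-- The `n`-th difference of the Hilbert function, i.e. the first difference of the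
`h`-vector. -/
def hDiff (I : Ideal (MvPolynomial (Fin (n + 1)) K)) : ℕ → ℤ :=
  difference^[n] (fun j => (hilbertFunction I j : ℤ))

theorem hDiff_eq_difference_hVector (hn : 1 ≤ n) (I : Ideal (MvPolynomial (Fin (n + 1)) K)) :
    hDiff I = difference (hVector I) := by
  obtain ⟨m, rfl⟩ := Nat.exists_eq_add_of_le' hn
  rw [hDiff, hVector, Nat.add_sub_cancel, Function.iterate_succ_apply']

theorem mk_hDiff (I : Ideal (MvPolynomial (Fin (n + 1)) K)) :
    PowerSeries.mk (hDiff I) = (1 - PowerSeries.X) ^ n * hilbertSeries I :=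
  mk_difference_iterate _ n

theorem hilbertFunction_eq_of_hDiff_eq {I J : Ideal (MvPolynomial (Fin (n + 1)) K)}
    (h : hDiff I = hDiff J) : hilbertFunction I = hilbertFunction J := by
  have h1 : hilbertSeries I = hilbertSeries J := by
    have h2 := congrArg (fun s => polynomialSeries n * ((1 - PowerSeries.X) *
      PowerSeries.mk s)) h
    simp only [mk_hDiff] at h2
    have h3 := one_sub_pow_mul_polynomialSeries n
    rw [pow_succ] at h3
    linear_combination h2 - (hilbertSeries I - hilbertSeries J) * h3
  funext j
  have := congrArg (PowerSeries.coeff j) h1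
  simpa [hilbertSeries] using this

theorem one_sub_pow_mul_polynomialSeries' (n : ℕ) :
    (1 - PowerSeries.X) ^ n * polynomialSeries n = PowerSeries.mk (1 : ℕ → ℤ) := by
  have h3 := one_sub_pow_mul_polynomialSeries n
  have h4 := PowerSeries.mk_one_mul_one_sub_eq_one ℤ
  rw [pow_succ] at h3
  linear_combination PowerSeries.mk (1 : ℕ → ℤ) * h3 -
    (1 - PowerSeries.X) ^ n * polynomialSeries n * h4

theorem IsBasicDoubleLink.isHomogeneous {I J : Ideal (MvPolynomial (Fin (n + 1)) K)}
    (hI : I.IsHomogeneous (homogeneousSubmodule (Fin (n + 1)) K)) {d b : ℕ}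
    (h : IsBasicDoubleLink I J d b) :
    J.IsHomogeneous (homogeneousSubmodule (Fin (n + 1)) K) := by
  obtain ⟨F, G, -, -, hF, -, hG, -, rfl⟩ := h
  exact (isHomogeneous_span_mul hI hG).sup (isHomogeneous_span_singleton hF)

theorem IsBasicDoubleLink.hDiff_apply {I J : Ideal (MvPolynomial (Fin (n + 1)) K)}
    (hI : I.IsHomogeneous (homogeneousSubmodule (Fin (n + 1)) K)) {d b : ℕ}
    (h : IsBasicDoubleLink I J d b) (j : ℕ) :
    hDiff J j = (if b ≤ j then hDiff I (j - b) else 0) + 1 - (if b ≤ j then 1 else 0) -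
      (if d ≤ j then 1 else 0) + (if b + d ≤ j then 1 else 0) := by
  obtain ⟨F, G, hFI, hF0, hF, hG0, hG, hFG, rfl⟩ := h
  have h1 := mk_hDiff (Ideal.span {G} * I ⊔ Ideal.span {F})
  rw [hilbertSeries_basicDoubleLink hI hFI hF0 hF hG0 hG hFG] at h1
  have h2 : PowerSeries.mk (hDiff (Ideal.span {G} * I ⊔ Ideal.span {F})) =
      PowerSeries.X ^ b * PowerSeries.mk (hDiff I) + PowerSeries.mk (1 : ℕ → ℤ) -
      PowerSeries.X ^ b * PowerSeries.mk (1 : ℕ → ℤ) -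
      PowerSeries.X ^ d * PowerSeries.mk (1 : ℕ → ℤ) +
      PowerSeries.X ^ (b + d) * PowerSeries.mk (1 : ℕ → ℤ) := by
    rw [h1, mk_hDiff, ← one_sub_pow_mul_polynomialSeries' n]
    ring
  have h3 := congrArg (PowerSeries.coeff j) h2
  simpa only [map_add, map_sub, PowerSeries.coeff_X_pow_mul', PowerSeries.coeff_mk,
    Pi.one_apply] using h3

theorem IsBasicDoubleLink.shiftedCohomologyIso {I J : Ideal (MvPolynomial (Fin (n + 1)) K)}
    {d b : ℕ} (h : IsBasicDoubleLink I J d b)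
    (hI : I.IsHomogeneous (homogeneousSubmodule (Fin (n + 1)) K))
    (hJ : J.IsHomogeneous (homogeneousSubmodule (Fin (n + 1)) K)) {p : ℕ} (hp : p + 2 ≤ n) :
    ShiftedCohomologyIso hI hJ b p := by
  obtain ⟨F, G, hFI, hF0, hF, hG0, hG, hFG, rfl⟩ := h
  have hsup : Ideal.span {G} * I ⊔ Ideal.span {F} ⊔ Ideal.span {G} =
      Ideal.span {F} ⊔ Ideal.span {G} := by
    rw [sup_right_comm, sup_eq_right.2 (Ideal.mul_le_left : Ideal.span {G} * I ≤ Ideal.span {G}),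
      sup_comm]
  refine ShiftedCohomologyIso.of_quotientMul hG (fun x hx => Ideal.mem_sup_left
    (Ideal.mul_mem_mul (Ideal.mem_span_singleton_self G) hx)) (fun x hx => ?_) fun q hq => ?_
  · obtain ⟨y, hy, z, hz, hyz⟩ := Submodule.mem_sup.1 hx
    obtain ⟨y, hyI, rfl⟩ := Ideal.mem_span_singleton_mul.1 hy
    have hdvd : F ∣ G * (x - y) := by
      rw [← Ideal.mem_span_singleton, mul_sub, ← hyz, add_sub_cancel_left]
      exact hz
    have hxy : x - y ∈ I := I.mem_of_dvd (hFG.dvd_of_dvd_mul_left hdvd) hFI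
    simpa using add_mem hxy hyI
  · rw [hsup]
    exact cechAcyclic_quotient_span_sup_span hF0 hFG (by omega)

end Hilbert

/-! ### The Hilbert series from a graded free resolution -/

section Resolution

variable {K : Type*} [Field K] {n : ℕ}

variable (K n) in
/-- The component of degree `j` of `R(-c)`. -/
def twistPiece (c j : ℕ) : Submodule K (MvPolynomial (Fin (n + 1)) K) :=
  if c ≤ j then homogeneousSubmodule (Fin (n + 1)) K (j - c) else ⊥

theorem mem_twistPiece_iff {c j : ℕ} {x : MvPolynomial (Fin (n + 1)) K} :
    x ∈ twistPiece K n c j ↔ polynomialProj K n (j - c) x = x := by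
  unfold twistPiece
  split_ifs with h
  · rw [← Nat.cast_sub h, polynomialProj_natCast, mem_homogeneousSubmodule]
    exact ⟨homogeneousComponent_of_isHomogeneous,
      fun hx => hx ▸ homogeneousComponent_isHomogeneous _ x⟩
  · rw [polynomialProj, if_neg (by omega), AddMonoidHom.zero_apply, Submodule.mem_bot, eq_comm]

theorem polynomialProj_mem_twistPiece (c j : ℕ) (x : MvPolynomial (Fin (n + 1)) K) :
    polynomialProj K n (j - c) x ∈ twistPiece K n c j := by
  unfold twistPiece
  split_ifs with h
  · rw [← Nat.cast_sub h, polynomialProj_natCast]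
    exact homogeneousComponent_isHomogeneous _ x
  · rw [polynomialProj, if_neg (by omega), AddMonoidHom.zero_apply]
    exact Submodule.zero_mem _

theorem finrank_twistPiece (c j : ℕ) : (Module.finrank K (twistPiece K n c j) : ℤ) =
    PowerSeries.coeff j (PowerSeries.X ^ c * polynomialSeries n) := by
  rw [PowerSeries.coeff_X_pow_mul', polynomialSeries, PowerSeries.coeff_mk]
  by_cases h : c ≤ j
  · rw [if_pos h, twistPiece, if_pos h, finrank_homogeneousSubmodule]
  · rw [if_neg h, twistPiece, if_neg h, finrank_bot, Nat.cast_zero]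

instance finiteDimensional_twistPiece (c j : ℕ) : Module.Finite K (twistPiece K n c j) := by
  by_cases h : c ≤ j
  · rw [twistPiece, if_pos h]
    infer_instance
  · rw [twistPiece, if_neg h]
    infer_instance

namespace MinimalFreeResolution

variable {I : Ideal (MvPolynomial (Fin (n + 1)) K)} (res : MinimalFreeResolution I)

/-- The component of degree `j` of the free module `F_p`. -/
def freePiece (p j : ℕ) : Submodule K (Fin (res.rank p) → MvPolynomial (Fin (n + 1)) K) :=
  Submodule.pi Set.univ fun k => twistPiece K n (res.shift p k) j

/-- The component of degree `j` of `F_p` as a product of the components of its summands. -/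
def freePieceEquiv (p j : ℕ) :
    res.freePiece p j ≃ₗ[K] ((k : Fin (res.rank p)) → twistPiece K n (res.shift p k) j) where
  toFun v k := ⟨v.1 k, v.2 k (Set.mem_univ k)⟩
  invFun w := ⟨fun k => (w k).1, fun k _ => (w k).2⟩
  map_add' _ _ := rfl
  map_smul' _ _ := rfl
  left_inv _ := rfl
  right_inv _ := rfl

instance finiteDimensional_freePiece (p j : ℕ) : Module.Finite K (res.freePiece p j) :=
  Module.Finite.equiv (res.freePieceEquiv p j).symm

theorem finrank_freePiece (p j : ℕ) : (Module.finrank K (res.freePiece p j) : ℤ) =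
    PowerSeries.coeff j ((∑ k, PowerSeries.X ^ res.shift p k) * polynomialSeries n) := by
  rw [(res.freePieceEquiv p j).finrank_eq, Module.finrank_pi_fintype, Finset.sum_mul, map_sum,
    Nat.cast_sum]
  exact Finset.sum_congr rfl fun k _ => finrank_twistPiece _ _

/-- The projection of `F_p` onto its component of degree `j`. -/
def freeProj (p j : ℕ) (v : Fin (res.rank p) → MvPolynomial (Fin (n + 1)) K) :
    Fin (res.rank p) → MvPolynomial (Fin (n + 1)) K :=
  fun k => polynomialProj K n (j - res.shift p k) (v k)

theorem mem_freePiece_iff {p j : ℕ} {v : Fin (res.rank p) → MvPolynomial (Fin (n + 1)) K} :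
    v ∈ res.freePiece p j ↔ res.freeProj p j v = v := by
  rw [freePiece, Submodule.mem_pi, funext_iff]
  exact ⟨fun h k => mem_twistPiece_iff.1 (h k (Set.mem_univ k)),
    fun h k _ => mem_twistPiece_iff.2 (h k)⟩

theorem freeProj_mem (p j : ℕ) (v : Fin (res.rank p) → MvPolynomial (Fin (n + 1)) K) :
    res.freeProj p j v ∈ res.freePiece p j :=
  fun k _ => polynomialProj_mem_twistPiece (res.shift p k) j (v k)

/-- The differential `F_{p+1} → F_p` over the ground field. -/
def diffK (p : ℕ) : (Fin (res.rank (p + 1)) → MvPolynomial (Fin (n + 1)) K) →ₗ[K]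
    (Fin (res.rank p) → MvPolynomial (Fin (n + 1)) K) :=
  (res.diff p).mulVecLin.restrictScalars K

theorem diffK_apply (p : ℕ) (v : Fin (res.rank (p + 1)) → MvPolynomial (Fin (n + 1)) K)
    (k : Fin (res.rank p)) : res.diffK p v k = ∑ l, res.diff p k l * v l := rfl

theorem diffK_freeProj (p j : ℕ)
    (v : Fin (res.rank (p + 1)) → MvPolynomial (Fin (n + 1)) K) :
    res.diffK p (res.freeProj (p + 1) j v) = res.freeProj p j (res.diffK p v) := by
  funext k
  rw [freeProj, diffK_apply, diffK_apply, map_sum]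
  refine Finset.sum_congr rfl fun l _ => ?_
  rcases res.homogeneous p k l with h | ⟨e, he, hh⟩
  · rw [h, zero_mul, zero_mul, map_zero]
  · rw [freeProj, ← polynomialProj_mul hh, ← he]
    congr 2
    push_cast
    ring

theorem freePiece_inf_ker (p j : ℕ) : res.freePiece (p + 1) j ⊓ LinearMap.ker (res.diffK p) =
    (res.freePiece (p + 2) j).map (res.diffK (p + 1)) := by
  have hex : ∀ v, res.diffK p v = 0 ↔ ∃ w, res.diffK (p + 1) w = v := fun v => by
    have := res.exact p
    exact ((Submodule.ext_iff.1 this v).symm)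
  ext v
  constructor
  · rintro ⟨hv, hv'⟩
    obtain ⟨w, rfl⟩ := (hex v).1 hv'
    refine ⟨_, res.freeProj_mem (p + 2) j w, ?_⟩
    rw [diffK_freeProj]
    exact res.mem_freePiece_iff.1 hv
  · rintro ⟨w, hw, rfl⟩
    refine ⟨?_, (hex _).2 ⟨w, rfl⟩⟩
    rw [SetLike.mem_coe, mem_freePiece_iff, ← diffK_freeProj, res.mem_freePiece_iff.1 hw]

/-- The image of the first differential of the resolution is `I`, degree by degree. -/
theorem finrank_map_diffK_zero (j : ℕ) :
    Module.finrank K ((res.freePiece 1 j).map (res.diffK 0)) =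
      Module.finrank K (idealPiece I j) := by
  let k₀ : Fin (res.rank 0) := ⟨0, by rw [res.rank_zero]; exact one_pos⟩
  have hk₀ : ∀ k, k = k₀ := by
    intro k
    have := k.2.trans_eq res.rank_zero
    exact Fin.ext (by simp only [k₀]; omega)
  let π : (Fin (res.rank 0) → MvPolynomial (Fin (n + 1)) K) →ₗ[K] MvPolynomial (Fin (n + 1)) K :=
    LinearMap.proj k₀
  have hπ : Function.Injective π := fun v w h => funext fun k => by rw [hk₀ k]; exact h
  rw [(Submodule.equivMapOfInjective π hπ _).finrank_eq]
  have hmem : ∀ x, x ∈ I ↔ ∃ v, res.diffK 0 v k₀ = x := by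
    intro x
    have hset : {f | ∃ k l, f = res.diff 0 k l} = Set.range (res.diff 0 k₀) := by
      ext f
      constructor
      · rintro ⟨k, l, rfl⟩
        exact ⟨l, by rw [hk₀ k]⟩
      · rintro ⟨l, rfl⟩
        exact ⟨k₀, l, rfl⟩
    have hx : x ∈ I ↔ x ∈ Ideal.span (Set.range (res.diff 0 k₀)) := by rw [← hset, res.span_eq]
    rw [hx, Ideal.mem_span_range_iff_exists_fun]
    refine exists_congr fun v => ?_
    rw [diffK_apply]
    simp only [mul_comm]
  suffices h : ((res.freePiece 1 j).map (res.diffK 0)).map π = idealPiece I j by rw [h]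
  ext x
  constructor
  · rintro ⟨_, ⟨v, hv, rfl⟩, rfl⟩
    refine ⟨?_, (hmem _).2 ⟨v, rfl⟩⟩
    have h := congrFun (res.diffK_freeProj 0 j v) k₀
    rw [res.mem_freePiece_iff.1 hv, freeProj, res.shift_zero, Nat.cast_zero, sub_zero,
      polynomialProj_natCast] at h
    change (res.diffK 0 v k₀).IsHomogeneous j
    rw [h]
    exact homogeneousComponent_isHomogeneous j _
  · rintro ⟨hx, hxI⟩
    obtain ⟨v, rfl⟩ := (hmem x).1 hxI
    refine ⟨_, ⟨_, res.freeProj_mem 1 j v, rfl⟩, ?_⟩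
    rw [diffK_freeProj]
    change res.freeProj 0 j (res.diffK 0 v) k₀ = res.diffK 0 v k₀
    rw [freeProj, res.shift_zero, Nat.cast_zero, sub_zero, polynomialProj_natCast]
    exact homogeneousComponent_of_isHomogeneous hx

/-- Exactness of the resolution of `I` in degree `j`, counted by dimensions. -/
theorem finrank_idealPiece_eq_sum (j : ℕ) : (Module.finrank K (idealPiece I j) : ℤ) =
    ∑ p ∈ Finset.range res.length, (-1) ^ p * (Module.finrank K (res.freePiece (p + 1) j) : ℤ) := by
  have hstep : ∀ m : ℕ, (Module.finrank K (idealPiece I j) : ℤ) =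
      ∑ p ∈ Finset.range m, (-1) ^ p * (Module.finrank K (res.freePiece (p + 1) j) : ℤ) +
        (-1) ^ m * (Module.finrank K ((res.freePiece (m + 1) j).map (res.diffK m)) : ℤ) := by
    intro m
    induction m with
    | zero => simp [finrank_map_diffK_zero]
    | succ m ih =>
      have h := finrank_map_add_finrank_inf_ker (res.diffK m) (res.freePiece (m + 1) j)
      rw [freePiece_inf_ker] at h
      rw [ih, Finset.sum_range_succ, ← h, pow_succ]
      push_cast
      ring
  have hzero : Module.finrank K
      ((res.freePiece (res.length + 1) j).map (res.diffK res.length)) = 0 := by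
    have hr := res.rank_eq_zero (res.length + 1) (Nat.lt_succ_self _)
    have hbot : res.freePiece (res.length + 1) j = ⊥ := by
      rw [eq_bot_iff]
      intro v _
      rw [Submodule.mem_bot]
      funext k
      have := k.2
      omega
    rw [hbot, Submodule.map_bot, finrank_bot]
  rw [hstep res.length, hzero]
  simp

theorem idealSeries_eq : idealSeries I =
    (∑ p ∈ Finset.range res.length, (-1) ^ p * ∑ k, PowerSeries.X ^ res.shift (p + 1) k) *
      polynomialSeries n := by
  ext j
  rw [idealSeries, PowerSeries.coeff_mk, finrank_idealPiece_eq_sum res, Finset.sum_mul, map_sum]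
  refine Finset.sum_congr rfl fun p _ => ?_
  rw [finrank_freePiece, mul_assoc]
  rcases Nat.even_or_odd p with h | h
  · simp [h.neg_one_pow]
  · simp [h.neg_one_pow]

theorem coeff_sum_X_pow_shift (p j : ℕ) :
    PowerSeries.coeff j (∑ k, PowerSeries.X ^ res.shift p k : PowerSeries ℤ) =
      ((res.shifts p).count j : ℤ) := by
  rw [map_sum, shifts, Multiset.count_map]
  simp only [PowerSeries.coeff_X_pow]
  rw [Finset.sum_boole]
  rfl

theorem count_oddShifts_sub_count_evenShifts (j : ℕ) :
    (res.oddShifts.count j : ℤ) - res.evenShifts.count j =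
      ∑ p ∈ Finset.range res.length, (-1) ^ p * ((res.shifts (p + 1)).count j : ℤ) := by
  have hIcc : Finset.Icc 1 res.length = (Finset.range res.length).map (addRightEmbedding 1) := by
    rw [Finset.range_eq_Ico, Finset.map_add_right_Ico]
    ext
    simp
  rw [oddShifts, evenShifts, Multiset.count_sum', Multiset.count_sum', Finset.sum_filter,
    Finset.sum_filter, hIcc, Finset.sum_map, Finset.sum_map, Nat.cast_sum, Nat.cast_sum,
    ← Finset.sum_sub_distrib]
  refine Finset.sum_congr rfl fun p _ => ?_
  simp only [addRightEmbedding_apply]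
  rcases Nat.even_or_odd p with h | h
  · rw [if_pos h.add_one, if_neg (Nat.not_even_iff_odd.2 h.add_one), h.neg_one_pow]
    simp
  · rw [if_neg (Nat.not_odd_iff_even.2 h.add_one), if_pos h.add_one, h.neg_one_pow]
    simp

/-- The `K`-polynomial of `R/I`, the numerator `1 - ∑ X^r + ∑ X^s` of its Hilbert series, in terms
of the differences of the `h`-vector. -/
theorem difference_hDiff_eq (j : ℕ) : difference (hDiff I) j =
    (if j = 0 then 1 else 0) - (res.oddShifts.count j : ℤ) + res.evenShifts.count j := by
  have h : PowerSeries.mk (difference (hDiff I)) = 1 -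
      ∑ p ∈ Finset.range res.length, (-1) ^ p * ∑ k, PowerSeries.X ^ res.shift (p + 1) k := by
    rw [mk_difference, mk_hDiff, hilbertSeries_eq, idealSeries_eq res]
    have h3 := one_sub_pow_mul_polynomialSeries n
    rw [pow_succ] at h3
    linear_combination (1 - ∑ p ∈ Finset.range res.length, (-1) ^ p *
      ∑ k, PowerSeries.X ^ res.shift (p + 1) k) * h3
  have h1 := congrArg (PowerSeries.coeff j) h
  rw [PowerSeries.coeff_mk, map_sub, PowerSeries.coeff_one, map_sum] at h1
  have h2 := res.count_oddShifts_sub_count_evenShifts j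
  have h4 : ∀ p ∈ Finset.range res.length, PowerSeries.coeff j ((-1 : PowerSeries ℤ) ^ p *
      ∑ k, PowerSeries.X ^ res.shift (p + 1) k) =
      (-1) ^ p * ((res.shifts (p + 1)).count j : ℤ) := by
    intro p _
    rw [← coeff_sum_X_pow_shift]
    rcases Nat.even_or_odd p with h | h
    · simp [h.neg_one_pow]
    · simp [h.neg_one_pow]
  rw [Finset.sum_congr rfl h4, ← h2] at h1
  rw [h1]
  ring

end MinimalFreeResolution

end Resolution

/-! ### The deficit and the main diagonal of the degree matrix -/

/-- The shape of the first difference `D` of an `h`-vector of an ideal of initial degree `α` and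
codimension at least two: it is `1` below `α`, not positive at `α` and vanishes eventually. -/
structure IsProfile (D : ℕ → ℤ) (α : ℕ) : Prop where
  one_le : 1 ≤ α
  eq_one : ∀ j < α, D j = 1
  nonpos : D α ≤ 0
  eventually_zero : ∃ B, ∀ j, B ≤ j → D j = 0

section Lists

/-- For two lists in decreasing order, the pairs at equal positions that straddle `j` are counted by
the excess of the entries of the second list beyond `j` over those of the first: these entries form
initial segments of the two lists, and the straddling positions are the difference. -/
theorem countP_zip_eq_max (j : ℕ) (s r : List ℕ) (hs : s.Pairwise (· ≥ ·))
    (hr : r.Pairwise (· ≥ ·)) (hlen : r.countP (fun x => j < x) ≤ s.length) :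
    ((List.zip s r).countP (fun q => q.1 ≤ j ∧ j < q.2) : ℤ) =
      max 0 ((r.countP (fun x => j < x) : ℤ) - s.countP (fun x => j < x)) := by
  induction s generalizing r with
  | nil =>
    rw [List.length_nil, Nat.le_zero] at hlen
    simp [hlen]
  | cons a s ih =>
    cases r with
    | nil =>
      simp only [List.zip_nil_right, List.countP_nil, Nat.cast_zero, zero_sub]
      rw [max_eq_left]
      omega
    | cons c r =>
      rw [List.pairwise_cons] at hs hr
      rw [List.zip_cons_cons, List.countP_cons, List.countP_cons, List.countP_cons]
      by_cases hc : j < c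
      · have hlen' : r.countP (fun x => j < x) ≤ s.length := by
          rw [List.countP_cons] at hlen
          simp only [hc, decide_true, if_true, List.length_cons] at hlen
          omega
        have := ih r hs.2 hr.2 hlen'
        by_cases ha : j < a
        · simp only [ha, hc, not_le.2 ha, and_true, decide_true, if_true, decide_false,
            Bool.false_eq_true, if_false]
          push_cast
          omega
        · have h0 : s.countP (fun x => j < x) = 0 := by
            rw [List.countP_eq_zero]
            intro x hx
            have := hs.1 x hx
            simp only [decide_eq_true_eq]
            omega
          simp only [ha, hc, not_lt.1 ha, and_true, decide_true, if_true, decide_false,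
            Bool.false_eq_true, if_false]
          push_cast
          omega
      · have h0 : r.countP (fun x => j < x) = 0 := by
          rw [List.countP_eq_zero]
          intro x hx
          have := hr.1 x hx
          simp only [decide_eq_true_eq]
          omega
        have h1 : (List.zip s r).countP (fun q => q.1 ≤ j ∧ j < q.2) = 0 := by
          rw [List.countP_eq_zero]
          rintro ⟨x, y⟩ hxy
          have := hr.1 y (List.of_mem_zip hxy).2
          simp only [decide_eq_true_eq]
          omega
        rw [h0, h1]
        simp only [hc, and_false, decide_false, Bool.false_eq_true, if_false]
        push_cast
        omega

/-- Double counting of the pairs `(q, j)` with `q.1 ≤ j < q.2`. -/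
theorem sum_countP_eq_sum_sub {α B : ℕ} (l : List (ℕ × ℕ)) (hl : ∀ q ∈ l, α ≤ q.1 ∧ q.2 ≤ B) :
    ∑ j ∈ Finset.Ico α B, l.countP (fun q => q.1 ≤ j ∧ j < q.2) =
      (l.map fun q => q.2 - q.1).sum := by
  induction l with
  | nil => simp
  | cons q l ih =>
    simp only [List.countP_cons, Finset.sum_add_distrib, List.map_cons, List.sum_cons]
    rw [ih fun q hq => hl q (List.mem_cons_of_mem _ hq), add_comm]
    congr 1
    have hq := hl q List.mem_cons_self
    simp only [decide_eq_true_eq]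
    rw [Finset.sum_boole, Nat.cast_id]
    have : (Finset.Ico α B).filter (fun j => q.1 ≤ j ∧ j < q.2) = Finset.Ico q.1 q.2 := by
      ext j
      simp only [Finset.mem_filter, Finset.mem_Ico]
      omega
    rw [this, Nat.card_Ico]

/-- The truncated subtraction makes the pairs that are not kept contribute `0`. -/
theorem sum_map_filter_sub (l : List (ℕ × ℕ)) :
    ((l.filter fun q => q.1 < q.2).map fun q => q.2 - q.1).sum =
      (l.map fun q => q.2 - q.1).sum := by
  induction l with
  | nil => rfl
  | cons q l ih =>
    by_cases h : q.1 < q.2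
    · rw [List.filter_cons_of_pos (by simpa using h)]
      simp [ih]
    · rw [List.filter_cons_of_neg (by simpa using h)]
      simp [ih, Nat.sub_eq_zero_of_le (not_lt.1 h)]

theorem countP_le_succ (s : Multiset ℕ) (j : ℕ) :
    s.countP (fun x => x ≤ j + 1) = s.countP (fun x => x ≤ j) + s.count (j + 1) := by
  induction s using Multiset.induction_on with
  | empty => simp
  | cons a s ih =>
    rw [Multiset.countP_cons, Multiset.countP_cons, Multiset.count_cons, ih]
    by_cases h1 : a ≤ j
    · rw [if_pos h1, if_pos (by omega), if_neg (by omega)]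
      ring
    · by_cases h2 : a = j + 1
      · rw [if_neg h1, if_pos (by omega), if_pos h2.symm]
        ring
      · rw [if_neg h1, if_neg (by omega), if_neg (Ne.symm h2)]
        ring

theorem countP_lt_add_countP_le (s : Multiset ℕ) (j : ℕ) :
    s.countP (fun x => j < x) + s.countP (fun x => x ≤ j) = s.card := by
  rw [Multiset.card_eq_countP_add_countP (fun x => j < x)]
  simp only [not_lt]

/-- Removing common elements does not change differences of numbers of elements. -/
theorem countP_sub_add_countP (O E : Multiset ℕ) (P : ℕ → Prop) [DecidablePred P] :
    (O - E).countP P + E.countP P = (E - O).countP P + O.countP P := by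
  have h1 := congrArg (Multiset.countP P) (Multiset.sub_add_inter O E)
  have h2 := congrArg (Multiset.countP P) (Multiset.sub_add_inter E O)
  rw [Multiset.countP_add] at h1 h2
  rw [Multiset.inter_comm] at h2
  omega

end Lists

section Profile

variable {K : Type*} [Field K] {n : ℕ} {I : Ideal (MvPolynomial (Fin (n + 1)) K)} {α : ℕ}

namespace MinimalFreeResolution

variable (res : MinimalFreeResolution I)

theorem hDiff_eq_countP (j : ℕ) : hDiff I j =
    1 - (res.oddShifts.countP (fun x => x ≤ j) : ℤ) + res.evenShifts.countP (fun x => x ≤ j) := by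
  induction j with
  | zero =>
    have h := res.difference_hDiff_eq 0
    rw [if_pos rfl] at h
    simp only [Nat.le_zero]
    have h0 : ∀ s : Multiset ℕ, s.countP (fun x => x = 0) = s.count 0 := fun s => by
      rw [Multiset.count]
      simp only [eq_comm]
    rw [h0, h0, ← h]
    rfl
  | succ j ih =>
    have h := res.difference_hDiff_eq (j + 1)
    rw [if_neg (Nat.succ_ne_zero j), difference] at h
    rw [countP_le_succ, countP_le_succ]
    push_cast
    linarith

theorem rList_pairwise : res.rList.Pairwise (· ≥ ·) := Multiset.pairwise_sort _ _

theorem sList_pairwise : res.sList.Pairwise (· ≥ ·) := Multiset.pairwise_sort _ _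

theorem countP_rList (P : ℕ → Prop) [DecidablePred P] :
    res.rList.countP (fun x => P x) = (res.oddShifts - res.evenShifts).countP P := by
  rw [← Multiset.coe_countP, rList, Multiset.sort_eq]

theorem countP_sList (P : ℕ → Prop) [DecidablePred P] :
    res.sList.countP (fun x => P x) = (res.evenShifts - res.oddShifts).countP P := by
  rw [← Multiset.coe_countP, sList, Multiset.sort_eq]

section

variable (hD : IsProfile (hDiff I) α)
include hD

theorem card_oddShifts : res.oddShifts.card = res.evenShifts.card + 1 := by
  obtain ⟨B, hB⟩ := hD.eventually_zero
  -- Evaluate `hDiff_eq_countP` at a degree beyond all shifts.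
  have hle : ∀ s : Multiset ℕ, ∃ C, ∀ j, C ≤ j → s.countP (fun x => x ≤ j) = s.card := by
    intro s
    refine ⟨s.sum, fun j hj => ?_⟩
    rw [Multiset.countP_eq_card]
    exact fun x hx => (Multiset.le_sum_of_mem hx).trans hj
  obtain ⟨C, hC⟩ := hle res.oddShifts
  obtain ⟨C', hC'⟩ := hle res.evenShifts
  have h := res.hDiff_eq_countP (max B (max C C'))
  rw [hB _ (le_max_left _ _), hC _ (by simp), hC' _ (by simp)] at h
  omega

/-- The sorted lists of cancelled shifts recover the first difference of the `h`-vector. -/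
theorem hDiff_eq_countP_sub_countP (j : ℕ) : hDiff I j =
    (res.rList.countP (fun x => j < x) : ℤ) - res.sList.countP (fun x => j < x) := by
  have h1 := res.hDiff_eq_countP j
  have h2 := res.card_oddShifts hD
  have h3 := countP_lt_add_countP_le res.oddShifts j
  have h4 := countP_lt_add_countP_le res.evenShifts j
  have h5 := countP_sub_add_countP res.oddShifts res.evenShifts (fun x => j < x)
  have h6 : res.rList.countP (fun x => j < x) =
    (res.oddShifts - res.evenShifts).countP (fun x => j < x) := res.countP_rList _
  have h7 : res.sList.countP (fun x => j < x) =
    (res.evenShifts - res.oddShifts).countP (fun x => j < x) := res.countP_sList _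
  omega

theorem length_rList : res.rList.length = res.sList.length + 1 := by
  have h2 := res.card_oddShifts hD
  have h5 := countP_sub_add_countP res.oddShifts res.evenShifts (fun _ => True)
  simp only [Multiset.countP_True] at h5
  rw [rList, sList, Multiset.length_sort, Multiset.length_sort]
  omega

theorem difference_hDiff_eq_zero {j : ℕ} (hj : j < α) (hj0 : j ≠ 0) :
    difference (hDiff I) j = 0 := by
  cases j with
  | zero => exact absurd rfl hj0
  | succ j => rw [difference, hD.eq_one _ hj, hD.eq_one _ (by omega), sub_self]

/-- Below `α` the odd and the even shifts cancel completely, by `difference_hDiff_eq`. -/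
theorem le_of_mem_sList {s : ℕ} (hs : s ∈ res.sList) : α ≤ s := by
  rw [sList, Multiset.mem_sort, Multiset.mem_sub] at hs
  by_contra! h
  have h1 := res.difference_hDiff_eq s
  by_cases h0 : s = 0
  · subst h0
    rw [if_pos rfl, difference, hD.eq_one 0 (by omega)] at h1
    omega
  · rw [difference_hDiff_eq_zero hD h h0, if_neg h0] at h1
    omega

/-- The first difference drops at the initial degree, so that a generator of this degree is left
after cancellation. -/
theorem mem_rList : α ∈ res.rList := by
  rw [rList, Multiset.mem_sort, Multiset.mem_sub]
  have h1 := res.difference_hDiff_eq α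
  obtain ⟨a, rfl⟩ := Nat.exists_eq_add_of_le' hD.one_le
  rw [if_neg (Nat.succ_ne_zero a), difference, hD.eq_one a (by omega)] at h1
  have := hD.nonpos
  omega

/-- The number of main diagonal entries straddling `j` is the positive part of the first
difference of the `h`-vector at `j`. -/
theorem countP_zip_eq_max_hDiff {j : ℕ} (hj : α ≤ j) :
    ((List.zip res.sList res.rList).countP (fun q => q.1 ≤ j ∧ j < q.2) : ℤ) =
      max 0 (hDiff I j) := by
  rw [res.hDiff_eq_countP_sub_countP hD]
  refine countP_zip_eq_max j _ _ res.sList_pairwise res.rList_pairwise ?_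
  -- The list of the `r`s is longer by one, and its entry `α` is not beyond `j`.
  have h1 := res.length_rList hD
  have h2 : res.rList.countP (fun x => j < x) ≠ res.rList.length := by
    rw [Ne, List.countP_eq_length]
    intro h
    have := h α (res.mem_rList hD)
    simp only [decide_eq_true_eq] at this
    omega
  have h3 : res.rList.countP (fun x => j < x) ≤ res.rList.length := List.countP_le_length
  omega

/-- The first difference of the `h`-vector is positive along the interval `[s, r)` of a negative
diagonal entry `s - r`; this is where the basic double link of the first algorithm lowers it. -/
theorem hDiff_pos_of_mem_negativeDiagonal {s r : ℕ} (h : (s, r) ∈ res.negativeDiagonal) :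
    α ≤ s ∧ s < r ∧ ∀ j, s ≤ j → j < r → 0 < hDiff I j := by
  rw [negativeDiagonal, List.mem_reverse, List.mem_filter] at h
  obtain ⟨hmem, hlt⟩ := h
  have hs := res.le_of_mem_sList hD (List.of_mem_zip hmem).1
  refine ⟨hs, by simpa using hlt, fun j hsj hjr => ?_⟩
  have h1 := res.countP_zip_eq_max_hDiff hD (hs.trans hsj)
  have h2 : 0 < (List.zip res.sList res.rList).countP (fun q => q.1 ≤ j ∧ j < q.2) :=
    List.countP_pos_iff.2 ⟨_, hmem, by simp [hsj, hjr]⟩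
  by_contra! h3
  rw [max_eq_left h3] at h1
  omega

theorem exists_sum_negativeEntries_eq : ∃ B₀, ∀ B, B₀ ≤ B →
    (res.negativeEntries.sum : ℤ) = ∑ j ∈ Finset.Ico α B, max 0 (hDiff I j) := by
  refine ⟨res.rList.sum, fun B hB => ?_⟩
  have h1 : res.negativeEntries.sum =
      ((List.zip res.sList res.rList).map fun q => q.2 - q.1).sum := by
    rw [negativeEntries, negativeDiagonal, List.map_reverse, List.sum_reverse, sum_map_filter_sub]
  have h2 := sum_countP_eq_sum_sub (α := α) (B := B) (List.zip res.sList res.rList) (by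
    rintro ⟨s, r⟩ h
    exact ⟨res.le_of_mem_sList hD (List.of_mem_zip h).1,
      (List.le_sum_of_mem (List.of_mem_zip h).2).trans hB⟩)
  rw [h1, ← h2, Nat.cast_sum]
  exact Finset.sum_congr rfl fun j hj =>
    res.countP_zip_eq_max_hDiff hD (Finset.mem_Ico.1 hj).1

end

end MinimalFreeResolution

section

variable (hn : 1 ≤ n) (hD : IsProfile (hDiff I) α)
include hn

theorem hDiff_succ (j : ℕ) : hDiff I (j + 1) = hVector I (j + 1) - hVector I j := by
  rw [hDiff_eq_difference_hVector hn, difference]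

include hD

theorem hVector_of_lt (j : ℕ) (hj : j < α) : hVector I j = j + 1 := by
  induction j with
  | zero =>
    have h := hD.eq_one 0 hj
    rw [hDiff_eq_difference_hVector hn, difference] at h
    simpa using h
  | succ j ih =>
    have h := hDiff_succ (I := I) hn j
    rw [hD.eq_one _ hj, ih (by omega)] at h
    push_cast
    linarith

theorem hVector_initial_le : hVector I α ≤ α := by
  obtain ⟨a, ha⟩ := Nat.exists_eq_add_of_le' hD.one_le
  have h := hDiff_succ (I := I) hn a
  rw [hVector_of_lt hn hD a (by omega), ← ha] at h
  have := hD.nonpos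
  rw [ha] at this h ⊢
  push_cast
  linarith

theorem deficit_eq_sum {B : ℕ} (hB : ∀ j, B ≤ j → hDiff I j = 0) :
    deficit I = ∑ j ∈ Finset.Ico α B, max 0 (hDiff I j) := by
  have hset : {i : ℕ | ∃ j ≤ i, hVector I j ≤ (j : ℤ)} = Set.Ici α := by
    ext i
    simp only [Set.mem_ofPred_eq, Set.mem_Ici]
    constructor
    · rintro ⟨j, hji, hj⟩
      by_contra! h
      rw [hVector_of_lt hn hD j (by omega)] at hj
      omega
    · exact fun h => ⟨α, h, hVector_initial_le hn hD⟩
  have hαB : α ≤ B := by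
    by_contra! h
    have := hB B le_rfl
    rw [hD.eq_one B h] at this
    omega
  rw [deficit, hset]
  simp only [← hDiff_succ hn]
  -- The shift of the index by one costs nothing, since the difference is not positive at `α`.
  have h1 : ∑ᶠ i ∈ Set.Ici α, max 0 (hDiff I (i + 1)) =
      ∑ i ∈ Finset.Ico α B, max 0 (hDiff I (i + 1)) := by
    refine finsum_mem_eq_sum_of_inter_support_eq _ ?_
    ext i
    simp only [Set.mem_inter_iff, Set.mem_Ici, Function.mem_support, Finset.coe_Ico, Set.mem_Ico]
    constructor
    · rintro ⟨hi, hne⟩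
      refine ⟨⟨hi, ?_⟩, hne⟩
      by_contra! h
      rw [hB (i + 1) (by omega)] at hne
      exact hne rfl
    · rintro ⟨⟨hi, -⟩, hne⟩
      exact ⟨hi, hne⟩
  have h2 : ∑ i ∈ Finset.Ico α B, max 0 (hDiff I (i + 1)) =
      ∑ i ∈ Finset.Ico (α + 1) (B + 1), max 0 (hDiff I i) :=
    Finset.sum_Ico_add' (fun i => max 0 (hDiff I i)) α B 1
  have h3 := Finset.sum_eq_sum_Ico_succ_bot (f := fun i => max 0 (hDiff I i))
    (show α < B + 1 by omega)
  have h4 := Finset.sum_Ico_succ_top hαB (fun i => max 0 (hDiff I i))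
  simp only [max_eq_left hD.nonpos, hB B le_rfl, max_self] at h3 h4
  rw [h1, h2]
  linarith

theorem MinimalFreeResolution.sum_negativeEntries (res : MinimalFreeResolution I) :
    (res.negativeEntries.sum : ℤ) = deficit I := by
  obtain ⟨B, hB⟩ := hD.eventually_zero
  obtain ⟨B₀, hB₀⟩ := res.exists_sum_negativeEntries_eq hD
  rw [hB₀ (max B B₀) (le_max_right _ _),
    deficit_eq_sum hn hD fun j hj => hB j ((le_max_left _ _).trans hj)]

theorem hDiff_nonpos_of_deficit_eq_zero (h : deficit I = 0) {j : ℕ} (hj : α ≤ j) :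
    hDiff I j ≤ 0 := by
  obtain ⟨B, hB⟩ := hD.eventually_zero
  by_cases hjB : j < B
  · rw [deficit_eq_sum hn hD hB, Finset.sum_eq_zero_iff_of_nonneg fun _ _ => le_max_left _ _] at h
    have := h j (Finset.mem_Ico.2 ⟨hj, hjB⟩)
    exact max_eq_left_iff.1 this
  · exact (hB j (not_lt.1 hjB)).le

end

end Profile

/-! ### O-sequences -/

theorem macaulayBound_of_le (i c : ℕ) (h : c ≤ i) : macaulayBound i c = c := by
  induction i generalizing c with
  | zero => rw [Nat.le_zero.1 h, macaulayBound]
  | succ i ih =>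
    rw [macaulayBound]
    split_ifs with hc
    · exact hc.symm
    · -- The binomial expansion of `c ≤ i + 1` consists of `c` terms `C(k, k) = 1`.
      have hk : Nat.findGreatest (fun k => k.choose (i + 1) ≤ c) (c + i + 1) = i + 1 := by
        rw [Nat.findGreatest_eq_iff]
        refine ⟨by omega, fun _ => ?_, fun k hk _ hle => ?_⟩
        · rw [Nat.choose_self]
          omega
        · have h1 := Nat.choose_le_choose (i + 1) (show i + 2 ≤ k by omega)
          have h2 : (i + 2).choose (i + 1) = i + 2 := Nat.choose_succ_self_right (i + 1)
          omega
      simp only [hk, Nat.choose_self]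
      rw [ih (c - 1) (by omega)]
      omega

/-- In degree `i`, Macaulay's bound for values up to `i` is the identity. -/
theorem IsOSequence.succ_le {a : ℕ → ℤ} (ha : IsOSequence a) {i : ℕ} (hi : a i ≤ i) :
    a (i + 1) ≤ a i := by
  obtain ⟨h0, hnonneg, hbound⟩ := ha
  have hi1 : 1 ≤ i := by
    by_contra! h
    obtain rfl : i = 0 := by omega
    rw [h0] at hi
    simp at hi
  have h1 := hbound i hi1
  have h2 := hnonneg i
  rwa [macaulayBound_of_le i _ (by omega), Int.toNat_of_nonneg h2] at h1

theorem deficit_eq_zero_of_isOSequence {K : Type*} [Field K] {n : ℕ}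
    {I : Ideal (MvPolynomial (Fin (n + 1)) K)} (hn : 1 ≤ n) {α : ℕ}
    (hD : IsProfile (hDiff I) α) (h : IsOSequence (hVector I)) : deficit I = 0 := by
  obtain ⟨B, hB⟩ := hD.eventually_zero
  -- The `h`-vector decreases from the initial degree on, by induction.
  have hle : ∀ k, hVector I (α + k) ≤ α := by
    intro k
    induction k with
    | zero => exact hVector_initial_le hn hD
    | succ k ih => exact (h.succ_le (ih.trans (by push_cast; omega))).trans ih
  rw [deficit_eq_sum hn hD hB]
  refine Finset.sum_eq_zero fun j hj => max_eq_left ?_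
  obtain ⟨k, rfl⟩ := Nat.exists_eq_add_of_le (Finset.mem_Ico.1 hj).1
  cases k with
  | zero => exact hD.nonpos
  | succ k =>
    rw [← Nat.add_assoc, hDiff_succ hn, sub_nonpos]
    exact h.succ_le ((hle k).trans (by push_cast; omega))

/-! ### Ideals of codimension at least two -/

section Codimension

variable {K : Type*} [Field K] {n : ℕ}

theorem exists_isHomogeneous_mem_notMem {A p : Ideal (MvPolynomial (Fin (n + 1)) K)}
    (hA : A.IsHomogeneous (homogeneousSubmodule (Fin (n + 1)) K)) (h : ¬ A ≤ p) :
    ∃ x ∈ A, x ∉ p ∧ ∃ e, x.IsHomogeneous e := by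
  by_contra! hc
  refine h fun x hx => ?_
  rw [← sum_homogeneousComponent x]
  refine sum_mem fun j _ => ?_
  by_contra hj
  exact hc _ (homogeneousComponent_mem_of_isHomogeneous hA j hx) hj j
    (homogeneousComponent_isHomogeneous j x)

theorem pos_of_isHomogeneous_mem {I : Ideal (MvPolynomial (Fin (n + 1)) K)} (hI : I ≠ ⊤)
    {x : MvPolynomial (Fin (n + 1)) K} (hx : x ∈ I) (hx0 : x ≠ 0) {e : ℕ}
    (he : x.IsHomogeneous e) : 0 < e := by
  by_contra! h
  obtain rfl : e = 0 := by omega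
  rw [← homogeneousComponent_of_isHomogeneous he, homogeneousComponent_zero] at hx hx0
  refine hI (I.eq_top_of_isUnit_mem hx (IsUnit.map C (isUnit_iff_ne_zero.2 fun h0 => hx0 ?_)))
  rw [h0, C_0]

/-- Homogeneous prime avoidance for finitely many incomparable homogeneous prime ideals. -/
theorem exists_isHomogeneous_mem_forall_notMem {I : Ideal (MvPolynomial (Fin (n + 1)) K)}
    (hI : I.IsHomogeneous (homogeneousSubmodule (Fin (n + 1)) K)) (htop : I ≠ ⊤)
    (s : Finset (Ideal (MvPolynomial (Fin (n + 1)) K)))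
    (hprime : ∀ p ∈ s, p.IsPrime)
    (hhom : ∀ p ∈ s, p.IsHomogeneous (homogeneousSubmodule (Fin (n + 1)) K))
    (hanti : ∀ p ∈ s, ∀ q ∈ s, p ≤ q → p = q) (hle : ∀ p ∈ s, ¬ I ≤ p) :
    ∃ g ∈ I, ∃ e, 0 < e ∧ g.IsHomogeneous e ∧ ∀ p ∈ s, g ∉ p := by
  classical
  induction s using Finset.induction_on with
  | empty => exact ⟨0, I.zero_mem, 1, one_pos, isHomogeneous_zero _ _ _, by simp⟩
  | insert p s hps ih =>
    simp only [Finset.mem_insert, forall_eq_or_imp] at hprime hhom hanti hle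
    obtain ⟨g, hgI, e, he, hg, hgs⟩ := ih hprime.2 hhom.2
      (fun q hq q' hq' => (hanti.2 q hq).2 q' hq') hle.2
    by_cases hgp : g ∈ p
    -- A form `f ∈ I` outside `p` and inside all `q ∈ s` repairs `g`, after powers have made the
    -- degrees equal.
    · have hpp := hprime.1
      have hprod : (∏ q ∈ s, q).IsHomogeneous (homogeneousSubmodule (Fin (n + 1)) K) :=
        Finset.prod_induction _ _ (fun _ _ ha hb => ha.mul hb)
          (by rw [Ideal.one_eq_top]; exact Ideal.IsHomogeneous.top _) fun q hq => hhom.2 q hq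
      have hnle : ¬ I * ∏ q ∈ s, q ≤ p := by
        rw [hpp.mul_le, hpp.prod_le]
        rintro (h | ⟨q, hq, h⟩)
        · exact hle.1 h
        · exact hps ((hanti.2 q hq).1 h ▸ hq)
      obtain ⟨f, hf, hfp, e', hfe⟩ := exists_isHomogeneous_mem_notMem (hI.mul hprod) hnle
      have hfI : f ∈ I := Ideal.mul_le_right (I := ∏ q ∈ s, q) (by rwa [mul_comm] at hf)
      have hfs : ∀ q ∈ s, f ∈ q := fun q hq =>
        (Ideal.le_of_dvd (Finset.dvd_prod_of_mem _ hq)) (Ideal.mul_le_right hf)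
      have he' : 0 < e' :=
        pos_of_isHomogeneous_mem htop hfI (fun h => hfp (h ▸ p.zero_mem)) hfe
      refine ⟨g ^ e' + f ^ e, add_mem (Ideal.pow_mem_of_mem I hgI e' he')
        (Ideal.pow_mem_of_mem I hfI e he), e * e', Nat.mul_pos he he', ?_, ?_⟩
      · refine (hg.pow e').add ?_
        rw [mul_comm]
        exact hfe.pow e
      · rw [Finset.forall_mem_insert]
        constructor
        · intro h
          exact hfp (hpp.mem_of_pow_mem e
            ((Ideal.add_mem_iff_right p (Ideal.pow_mem_of_mem p hgp e' he')).1 h))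
        · intro q hq h
          exact hgs q hq ((hprime.2 q hq).mem_of_pow_mem e'
            ((Ideal.add_mem_iff_left q (Ideal.pow_mem_of_mem q (hfs q hq) e he)).1 h))
    · refine ⟨g, hgI, e, he, hg, ?_⟩
      rw [Finset.forall_mem_insert]
      exact ⟨hgp, hgs⟩

/-- The principal ideal of a prime factor of a form is homogeneous: its homogeneous core is a
nonzero prime ideal contained in it. -/
theorem isHomogeneous_span_of_prime_of_dvd {F P : MvPolynomial (Fin (n + 1)) K} (hF0 : F ≠ 0)
    {d : ℕ} (hF : F.IsHomogeneous d) (hP : Prime P) (hPF : P ∣ F) :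
    (Ideal.span {P}).IsHomogeneous (homogeneousSubmodule (Fin (n + 1)) K) := by
  have hprime : (Ideal.span {P}).IsPrime := (Ideal.span_singleton_prime hP.ne_zero).2 hP
  set A := (Ideal.span {P}).homogeneousCore (homogeneousSubmodule (Fin (n + 1)) K) with hA
  have hle : A.toIdeal ≤ Ideal.span {P} := Ideal.toIdeal_homogeneousCore_le _ _
  have hAprime : A.toIdeal.IsPrime := hprime.homogeneousCore
  have hFA : F ∈ A.toIdeal :=
    Ideal.mem_homogeneousCore_of_homogeneous_of_mem ⟨d, hF⟩ (Ideal.mem_span_singleton.2 hPF)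
  have hbot : A.toIdeal ≠ ⊥ := fun h => hF0 (by rwa [h, Ideal.mem_bot] at hFA)
  obtain ⟨Q, hQA, hQ⟩ := hAprime.exists_mem_prime_of_ne_bot hbot
  have hass : Associated P Q :=
    hP.associated_of_dvd hQ (Ideal.mem_span_singleton.1 (hle hQA))
  have heq : A.toIdeal = Ideal.span {P} := by
    refine le_antisymm hle ?_
    rw [Ideal.span_singleton_eq_span_singleton.2 hass, Ideal.span_singleton_le_iff_mem]
    exact hQA
  rw [← heq]
  exact A.isHomogeneous

theorem ne_bot_of_two_le_height {R : Type*} [CommRing R] [IsDomain R] {I : Ideal R}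
    (h : 2 ≤ I.height) : I ≠ ⊥ := by
  rintro rfl
  rw [Ideal.height_bot] at h
  exact absurd h (by norm_num)

/-- Krull's principal ideal theorem. -/
theorem not_le_span_of_two_le_height {I : Ideal (MvPolynomial (Fin (n + 1)) K)}
    (h : 2 ≤ I.height) {P : MvPolynomial (Fin (n + 1)) K} (hP : Prime P) :
    ¬ I ≤ Ideal.span {P} := by
  intro hle
  have hprime : (Ideal.span {P}).IsPrime := (Ideal.span_singleton_prime hP.ne_zero).2 hP
  have hmin : Ideal.span {P} ∈ (Ideal.span {P}).minimalPrimes := by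
    rw [Ideal.minimalPrimes_eq_subsingleton_self]
    exact Set.mem_singleton _
  have h1 := Ideal.height_le_one_of_isPrincipal_of_mem_minimalPrimes (Ideal.span {P}) _ hmin
  have h2 := (h.trans (Ideal.height_mono hle)).trans h1
  exact absurd h2 (by norm_num)

/-- An ideal of codimension at least two contains a complete intersection of two forms: a second
form avoids the principal primes of the factors of a first one. -/
theorem exists_isRelPrime_forms_of_two_le_height {I : Ideal (MvPolynomial (Fin (n + 1)) K)}
    (hI : I.IsHomogeneous (homogeneousSubmodule (Fin (n + 1)) K)) (htop : I ≠ ⊤)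
    (h : 2 ≤ I.height) :
    ∃ F ∈ I, ∃ G ∈ I, ∃ d b, F ≠ 0 ∧ F.IsHomogeneous d ∧ G ≠ 0 ∧ G.IsHomogeneous b ∧
      IsRelPrime F G := by
  classical
  have hbot : ¬ I ≤ ⊥ := fun hle => ne_bot_of_two_le_height h (le_bot_iff.1 hle)
  obtain ⟨F, hFI, hF0, d, hF⟩ := exists_isHomogeneous_mem_notMem hI hbot
  rw [Ideal.mem_bot] at hF0
  have hfac : ∀ P ∈ UniqueFactorizationMonoid.factors F, Prime P ∧ P ∣ F := fun P hP =>
    ⟨UniqueFactorizationMonoid.prime_of_factor P hP,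
      UniqueFactorizationMonoid.dvd_of_mem_factors hP⟩
  obtain ⟨G, hGI, b, -, hG, hGs⟩ := exists_isHomogeneous_mem_forall_notMem hI htop
    ((UniqueFactorizationMonoid.factors F).toFinset.image fun P => Ideal.span {P})
    (by
      simp only [Finset.mem_image, Multiset.mem_toFinset]
      rintro _ ⟨P, hP, rfl⟩
      exact (Ideal.span_singleton_prime (hfac P hP).1.ne_zero).2 (hfac P hP).1)
    (by
      simp only [Finset.mem_image, Multiset.mem_toFinset]
      rintro _ ⟨P, hP, rfl⟩
      exact isHomogeneous_span_of_prime_of_dvd hF0 hF (hfac P hP).1 (hfac P hP).2)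
    (by
      simp only [Finset.mem_image, Multiset.mem_toFinset]
      rintro _ ⟨P, hP, rfl⟩ _ ⟨Q, hQ, rfl⟩ hle
      rw [Ideal.span_singleton_le_span_singleton] at hle
      exact Ideal.span_singleton_eq_span_singleton.2
        ((hfac Q hQ).1.associated_of_dvd (hfac P hP).1 hle).symm)
    (by
      simp only [Finset.mem_image, Multiset.mem_toFinset]
      rintro _ ⟨P, hP, rfl⟩
      exact not_le_span_of_two_le_height h (hfac P hP).1)
  simp only [Finset.mem_image, Multiset.mem_toFinset, forall_exists_index, and_imp,
    forall_apply_eq_imp_iff₂, Ideal.mem_span_singleton] at hGs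
  have hrel : IsRelPrime F G := by
    rw [UniqueFactorizationMonoid.isRelPrime_iff_no_prime_factors hF0]
    intro P hPF hPG hP
    obtain ⟨Q, hQ, hPQ⟩ := UniqueFactorizationMonoid.exists_mem_factors_of_dvd hF0
      hP.irreducible hPF
    exact hGs Q hQ (hPQ.symm.dvd.trans hPG)
  refine ⟨F, hFI, G, hGI, d, b, hF0, hF, ?_, hG, hrel⟩
  -- If `G` were `0`, then `F ∈ I` would be a unit.
  rintro rfl
  exact htop (I.eq_top_of_isUnit_mem hFI (hrel dvd_rfl (dvd_zero F)))

/-! ### Finiteness of the `h`-vector -/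

/-- A function whose first difference is eventually at most `-1` tends to `-∞`. -/
theorem eventually_neg_of_difference_iterate {m : ℕ} {f : ℕ → ℤ}
    (h : ∃ B, ∀ j, B ≤ j → difference^[m] f j ≤ -1) : ∃ B, ∀ j, B ≤ j → f j ≤ -1 := by
  induction m generalizing f with
  | zero => exact h
  | succ m ih =>
    rw [Function.iterate_succ] at h
    obtain ⟨B, hB⟩ := ih h
    have hlin : ∀ k : ℕ, f (B + k) ≤ f B - k := by
      intro k
      induction k with
      | zero => simp
      | succ k ihk =>
        have h1 := hB (B + k + 1) (by omega)
        rw [difference] at h1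
        rw [← Nat.add_assoc]
        push_cast
        linarith
    refine ⟨B + (f B).toNat + 1, fun j hj => ?_⟩
    obtain ⟨k, rfl⟩ := Nat.exists_eq_add_of_le (show B ≤ j by omega)
    have := hlin k
    omega

/-- If some iterated difference of a nonnegative function is eventually constant, the
constant is nonnegative. -/
theorem nonneg_of_difference_iterate_eventually_eq {m : ℕ} {f : ℕ → ℤ} (hf : ∀ j, 0 ≤ f j)
    {κ : ℤ} (h : ∃ B, ∀ j, B ≤ j → difference^[m] f j = κ) : 0 ≤ κ := by
  by_contra! hκ
  obtain ⟨B, hB⟩ := h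
  obtain ⟨B', hB'⟩ := eventually_neg_of_difference_iterate (m := m) (f := f)
    ⟨B, fun j hj => by rw [hB j hj]; omega⟩
  have h1 := hB' B' le_rfl
  have h2 := hf B'
  omega

theorem difference_iterate_sub (m : ℕ) (f g : ℕ → ℤ) (j : ℕ) :
    difference^[m] (fun i => f i - g i) j = difference^[m] f j - difference^[m] g j := by
  induction m generalizing f g with
  | zero => rfl
  | succ m ih =>
    rw [Function.iterate_succ, Function.comp_apply, Function.comp_apply, Function.comp_apply, ← ih]
    have h : difference (fun i => f i - g i) = fun i => difference f i - difference g i := by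
      funext i
      cases i with
      | zero => rfl
      | succ i => simp only [difference]; ring
    rw [h]

theorem hDiff_top (j : ℕ) : hDiff (⊤ : Ideal (MvPolynomial (Fin (n + 1)) K)) j = 0 := by
  have h : PowerSeries.mk (hDiff (⊤ : Ideal (MvPolynomial (Fin (n + 1)) K))) = 0 := by
    rw [mk_hDiff, hilbertSeries_eq, idealSeries_top, sub_self, mul_zero]
  have := congrArg (PowerSeries.coeff j) h
  simpa using this

/-- The `h`-vector of a complete intersection of two forms is finite. -/
theorem hVector_completeIntersection_eventually_zero (hn : 1 ≤ n)
    {J : Ideal (MvPolynomial (Fin (n + 1)) K)} {d b : ℕ} (h : IsBasicDoubleLink ⊤ J d b) :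
    ∃ B, ∀ j, B ≤ j → hVector J j = 0 := by
  have hD : ∀ j, hDiff J j = 1 - (if b ≤ j then 1 else 0) -
      (if d ≤ j then 1 else 0) + (if b + d ≤ j then 1 else 0) := by
    intro j
    rw [h.hDiff_apply (Ideal.IsHomogeneous.top _), hDiff_top, ite_self]
    ring
  have hV : ∀ j, hVector J j = (j + 1 : ℤ) - max 0 (j + 1 - b) - max 0 (j + 1 - d) +
      max 0 (j + 1 - b - d) := by
    intro j
    induction j with
    | zero =>
      have h1 := hD 0
      rw [hDiff_eq_difference_hVector hn, difference] at h1
      rw [h1]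
      push_cast
      split_ifs <;> omega
    | succ j ih =>
      have h1 := hDiff_succ (I := J) hn j
      rw [hD, ih] at h1
      push_cast
      split_ifs at h1 <;> omega
  refine ⟨b + d, fun j hj => ?_⟩
  rw [hV]
  omega

/-- The `h`-vector of an ideal of codimension at least two is finite. The resolution makes its first
difference eventually constant; comparison with a complete intersection of two forms in the ideal
shows that the constant is `0`, and then that the `h`-vector itself is eventually `0`. -/
theorem hVector_eventually_zero (hn : 1 ≤ n) {I : Ideal (MvPolynomial (Fin (n + 1)) K)}
    (hI : I.IsHomogeneous (homogeneousSubmodule (Fin (n + 1)) K)) (htop : I ≠ ⊤)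
    (h : 2 ≤ I.height) (res : MinimalFreeResolution I) :
    ∃ B, ∀ j, B ≤ j → hVector I j = 0 := by
  obtain ⟨F, hFI, G, hGI, d, b, hF0, hF, hG0, hG, hFG⟩ :=
    exists_isRelPrime_forms_of_two_le_height hI htop h
  set J : Ideal (MvPolynomial (Fin (n + 1)) K) := Ideal.span {G} * ⊤ ⊔ Ideal.span {F} with hJ
  have hlink : IsBasicDoubleLink ⊤ J d b :=
    ⟨F, G, Submodule.mem_top, hF0, hF, hG0, hG, hFG, rfl⟩
  obtain ⟨B₁, hB₁⟩ := hVector_completeIntersection_eventually_zero hn hlink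
  have hJI : J ≤ I := by
    rw [hJ, Ideal.mul_top]
    exact sup_le ((Ideal.span_singleton_le_iff_mem I).2 hGI)
      ((Ideal.span_singleton_le_iff_mem I).2 hFI)
  have hnonneg : ∀ j, (0 : ℤ) ≤ hilbertFunction I j := fun j => Int.natCast_nonneg _
  have hnonneg' : ∀ j, (0 : ℤ) ≤ (hilbertFunction J j : ℤ) - hilbertFunction I j := fun j =>
    sub_nonneg.2 (by exact_mod_cast hilbertFunction_anti hJI j)
  have hD₁ : ∀ j, B₁ + 1 ≤ j → hDiff J j = 0 := by
    intro j hj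
    obtain ⟨i, rfl⟩ := Nat.exists_eq_add_of_le' (show 1 ≤ j by omega)
    rw [hDiff_succ hn, hB₁ _ (by omega), hB₁ _ (by omega), sub_self]
  -- The resolution shows that the first difference of the `h`-vector is eventually constant.
  obtain ⟨κ, B₂, hB₂⟩ : ∃ κ B, ∀ j, B ≤ j → hDiff I j = κ := by
    have hle : ∀ s : Multiset ℕ, ∃ C, ∀ j, C ≤ j → s.countP (fun x => x ≤ j) = s.card := by
      intro s
      refine ⟨s.sum, fun j hj => ?_⟩
      rw [Multiset.countP_eq_card]
      exact fun x hx => (Multiset.le_sum_of_mem hx).trans hj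
    obtain ⟨C, hC⟩ := hle res.oddShifts
    obtain ⟨C', hC'⟩ := hle res.evenShifts
    refine ⟨1 - (res.oddShifts.card : ℤ) + res.evenShifts.card, max C C', fun j hj => ?_⟩
    rw [res.hDiff_eq_countP, hC j ((le_max_left _ _).trans hj),
      hC' j ((le_max_right _ _).trans hj)]
  -- Comparison with `0` and with the complete intersection squeezes the constant to `0`.
  have hκ : κ = 0 := by
    refine le_antisymm ?_ (nonneg_of_difference_iterate_eventually_eq (m := n) hnonneg ⟨B₂, hB₂⟩)
    have := nonneg_of_difference_iterate_eventually_eq (m := n) hnonneg' (κ := -κ)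
      ⟨max (B₁ + 1) B₂, fun j hj => by
        rw [difference_iterate_sub]
        change hDiff J j - hDiff I j = -κ
        rw [hD₁ j ((le_max_left _ _).trans hj), hB₂ j ((le_max_right _ _).trans hj), zero_sub]⟩
    omega
  subst hκ
  -- Hence the `h`-vector is eventually constant, and the same comparison applies to it.
  have hconst : ∀ j, B₂ ≤ j → hVector I j = hVector I B₂ := by
    intro j hj
    induction j, hj using Nat.le_induction with
    | base => rfl
    | succ j hj ih =>
      have := hDiff_succ (I := I) hn j
      rw [hB₂ (j + 1) (by omega)] at this
      omega
  have hzero : hVector I B₂ = 0 := by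
    refine le_antisymm ?_
      (nonneg_of_difference_iterate_eventually_eq (m := n - 1) hnonneg ⟨B₂, hconst⟩)
    have := nonneg_of_difference_iterate_eventually_eq (m := n - 1) hnonneg'
      (κ := -hVector I B₂) ⟨max B₁ B₂, fun j hj => by
        rw [difference_iterate_sub]
        change hVector J j - hVector I j = _
        rw [hB₁ j ((le_max_left _ _).trans hj), hconst j ((le_max_right _ _).trans hj), zero_sub]⟩
    omega
  exact ⟨B₂, fun j hj => (hconst j hj).trans hzero⟩

/-- Below the initial degree `α` of `I`, the first difference of the `h`-vector agrees with the
`n`-th difference of the Hilbert function of `R`, which is `1` everywhere; at `α` it is smaller. -/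
theorem exists_isProfile (hn : 1 ≤ n) {I : Ideal (MvPolynomial (Fin (n + 1)) K)}
    (hI : I.IsHomogeneous (homogeneousSubmodule (Fin (n + 1)) K)) (htop : I ≠ ⊤) (hbot : I ≠ ⊥)
    (hV : ∃ B, ∀ j, B ≤ j → hVector I j = 0) : ∃ α, IsProfile (hDiff I) α := by
  classical
  have hex : ∃ j, idealPiece I j ≠ ⊥ := by
    obtain ⟨x, hx, hx0, e, he⟩ := exists_isHomogeneous_mem_notMem hI
      (p := ⊥) fun h => hbot (le_bot_iff.1 h)
    refine ⟨e, fun h => hx0 ?_⟩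
    have : x ∈ idealPiece I e := ⟨he, hx⟩
    rwa [h] at this
  -- `α` is the initial degree of `I`.
  set α := Nat.find hex with hα
  have hlow : ∀ j < α, idealPiece I j = ⊥ := fun j hj => not_not.1 (Nat.find_min hex hj)
  have hser : PowerSeries.mk (hDiff I) + (1 - PowerSeries.X) ^ n * idealSeries I =
      PowerSeries.mk (1 : ℕ → ℤ) := by
    rw [mk_hDiff, hilbertSeries_eq, ← one_sub_pow_mul_polynomialSeries' n]
    ring
  -- Since `[I]_j = 0` for `j < α`, the series of `I` is divisible by `X ^ α`.
  have hdvd : PowerSeries.X ^ α ∣ idealSeries I := by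
    rw [PowerSeries.X_pow_dvd_iff]
    intro j hj
    rw [idealSeries, PowerSeries.coeff_mk, hlow j hj, finrank_bot, Nat.cast_zero]
  obtain ⟨φ, hφ⟩ := hdvd
  have hcoef : ∀ j, hDiff I j = 1 -
      if α ≤ j then PowerSeries.coeff (j - α) ((1 - PowerSeries.X) ^ n * φ) else 0 := by
    intro j
    have h := congrArg (PowerSeries.coeff j) hser
    rw [hφ, mul_left_comm, map_add, PowerSeries.coeff_X_pow_mul', PowerSeries.coeff_mk,
      PowerSeries.coeff_mk, Pi.one_apply] at h
    linarith
  have hα1 : 1 ≤ α := by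
    by_contra! h
    have h0 := Nat.find_spec hex
    rw [← hα] at h0
    obtain ⟨x, hx, hx0⟩ := (Submodule.ne_bot_iff _).1 h0
    have := pos_of_isHomogeneous_mem htop hx.2 hx0 hx.1
    omega
  refine ⟨α, hα1, fun j hj => ?_, ?_, ?_⟩
  · rw [hcoef, if_neg (by omega), sub_zero]
  · have h1 : PowerSeries.coeff α (idealSeries I) = PowerSeries.coeff 0 φ := by
      rw [hφ, PowerSeries.coeff_X_pow_mul', if_pos le_rfl, Nat.sub_self]
    have h2 : (1 : ℤ) ≤ PowerSeries.coeff α (idealSeries I) := by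
      rw [idealSeries, PowerSeries.coeff_mk]
      have h0 := Nat.find_spec hex
      rw [← hα] at h0
      have := Submodule.one_le_finrank_iff.2 h0
      exact_mod_cast this
    rw [hcoef, if_pos le_rfl, Nat.sub_self]
    simp only [PowerSeries.coeff_zero_eq_constantCoeff, map_mul, map_pow, map_sub, map_one,
      PowerSeries.constantCoeff_X, sub_zero, one_pow, one_mul]
    rw [← PowerSeries.coeff_zero_eq_constantCoeff_apply, ← h1]
    omega
  · obtain ⟨B, hB⟩ := hV
    refine ⟨B + 1, fun j hj => ?_⟩
    obtain ⟨i, rfl⟩ := Nat.exists_eq_add_of_le' (show 1 ≤ j by omega)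
    rw [hDiff_succ hn, hB _ (by omega), hB _ (by omega), sub_self]

theorem isCohenMacaulayIdeal_of_ringKrullDim_le_zero
    {I : Ideal (MvPolynomial (Fin (n + 1)) K)}
    (h : ringKrullDim (MvPolynomial (Fin (n + 1)) K ⧸ I) ≤ 0) : IsCohenMacaulayIdeal I :=
  ⟨[], by simp, RingTheory.Sequence.IsWeaklyRegular.nil _ _, by simpa using h⟩

/-- A proper ideal of codimension at least two that is not Cohen-Macaulay exists in at least three
variables only. -/
theorem two_le_of_not_isCohenMacaulayIdeal {I : Ideal (MvPolynomial (Fin (n + 1)) K)}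
    (h : 2 ≤ I.height) (hCM : ¬ IsCohenMacaulayIdeal I) : 2 ≤ n := by
  by_contra! hn
  refine hCM (isCohenMacaulayIdeal_of_ringKrullDim_le_zero ?_)
  have hdim : ringKrullDim (MvPolynomial (Fin (n + 1)) K) = ((n + 1 : ℕ) : WithBot ℕ∞) := by
    rw [MvPolynomial.ringKrullDim_of_isNoetherianRing, ringKrullDim_eq_zero_of_field, zero_add]
    simp
  have hle : ∀ q : Ideal (MvPolynomial (Fin (n + 1)) K), q.IsPrime → q.height ≤ 2 := by
    intro q hq
    have h1 := Ideal.height_le_ringKrullDim_of_ne_top hq.ne_top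
    rw [hdim] at h1
    have h2 : q.height ≤ ((n + 1 : ℕ) : ℕ∞) := by exact_mod_cast h1
    exact h2.trans (by exact_mod_cast (show n + 1 ≤ 2 by omega))
  -- In at most two variables a prime ideal of height two is maximal.
  have hmax : ∀ p : Ideal (MvPolynomial (Fin (n + 1)) K ⧸ I), p.IsPrime → p.IsMaximal := by
    intro p hp
    obtain ⟨m, hm, hpm⟩ := p.exists_le_maximal hp.ne_top
    have hmp := hm.isPrime
    have hIp : I ≤ p.comap (Ideal.Quotient.mk I) := by
      intro x hx
      rw [Ideal.mem_comap, Ideal.Quotient.eq_zero_iff_mem.2 hx]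
      exact p.zero_mem
    by_cases hne : p = m
    · exact hne ▸ hm
    · have hlt : p.comap (Ideal.Quotient.mk I) < m.comap (Ideal.Quotient.mk I) :=
        lt_of_le_of_ne (Ideal.comap_mono hpm) fun he =>
          hne (Ideal.comap_injective_of_surjective _ Ideal.Quotient.mk_surjective he)
      have h1 := (h.trans (Ideal.height_mono hIp)).trans_lt
        (Ideal.height_strict_mono_of_isPrime_of_isPrime hlt)
      exact absurd (hle _ (Ideal.comap_isPrime _ m)) (not_le.2 h1)
  have := Ring.krullDimLE_zero_iff.2 hmax
  exact Ring.krullDimLE_iff.1 this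

end Codimension

/-! ### The effect of a step of the algorithms -/

section Step

variable {K : Type*} [Field K] {n : ℕ} {I I' J : Ideal (MvPolynomial (Fin (n + 1)) K)}
  {α d b δ : ℕ}

/-- A basic double link of type `(d, b)` shifts the difference of the `h`-vector by `b` and lowers
it by `1` at the places that come from `[d - b, d)`. -/
theorem IsBasicDoubleLink.hDiff_add
    (hI : I.IsHomogeneous (homogeneousSubmodule (Fin (n + 1)) K))
    (h : IsBasicDoubleLink I I' d b) (j : ℕ) :
    hDiff I' (j + b) = hDiff I j - if d ≤ j + b ∧ j < d then 1 else 0 := by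
  rw [h.hDiff_apply hI, Nat.add_sub_cancel, if_pos (Nat.le_add_left b j),
    if_pos (Nat.le_add_left b j)]
  split_ifs <;> omega

theorem IsBasicDoubleLink.hDiff_of_lt
    (hI : I.IsHomogeneous (homogeneousSubmodule (Fin (n + 1)) K))
    (h : IsBasicDoubleLink I I' d b) {j : ℕ} (hj : j < b) (hjd : j < d) : hDiff I' j = 1 := by
  rw [h.hDiff_apply hI, if_neg (by omega), if_neg (by omega), if_neg (by omega),
    if_neg (by omega)]
  ring

section

variable (hI : I.IsHomogeneous (homogeneousSubmodule (Fin (n + 1)) K))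
  (hD : IsProfile (hDiff I) α) (h : IsBasicDoubleLink I I' d b) (hd : α + b ≤ d)
include hI hD h hd

/-- A basic double link of height `b` raises the initial degree by `b`. -/
theorem IsBasicDoubleLink.isProfile : IsProfile (hDiff I') (α + b) := by
  refine ⟨hD.one_le.trans (Nat.le_add_right α b), fun j hj => ?_, ?_, ?_⟩
  · by_cases hjb : j < b
    · exact h.hDiff_of_lt hI hjb (by omega)
    · obtain ⟨i, rfl⟩ := Nat.exists_eq_add_of_le' (not_lt.1 hjb)
      rw [h.hDiff_add hI, hD.eq_one i (by omega), if_neg (by omega), sub_zero]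
  · rw [h.hDiff_add hI]
    have := hD.nonpos
    split_ifs <;> omega
  · obtain ⟨B, hB⟩ := hD.eventually_zero
    refine ⟨max B d + b, fun j hj => ?_⟩
    obtain ⟨i, rfl⟩ := Nat.exists_eq_add_of_le' (show b ≤ j by omega)
    rw [h.hDiff_add hI, hB i (by omega), if_neg (by omega), sub_zero]

variable (hpos : ∀ j, d ≤ j + b → j < d → 0 < hDiff I j)
include hpos

omit hD hd in
/-- If the difference of the `h`-vector is positive on `[d - b, d)`, then its negative part is just
shifted. -/
theorem IsBasicDoubleLink.min_hDiff_add (j : ℕ) :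
    min 0 (hDiff I' (j + b)) = min 0 (hDiff I j) := by
  rw [h.hDiff_add hI]
  split_ifs with hj
  · have := hpos j hj.1 hj.2
    omega
  · rw [sub_zero]

/-- If the difference of the `h`-vector is positive on `[d - b, d)`, then the deficit drops by the
number `b` of these places. -/
theorem IsBasicDoubleLink.deficit_add (hn : 1 ≤ n) : deficit I' + b = deficit I := by
  obtain ⟨B, hB⟩ := hD.eventually_zero
  have hB₁ : ∀ j, max B d ≤ j → hDiff I j = 0 := fun j hj => hB j (by omega)
  have hB₂ : ∀ j, max B d + b ≤ j → hDiff I' j = 0 := by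
    intro j hj
    obtain ⟨i, rfl⟩ := Nat.exists_eq_add_of_le' (show b ≤ j by omega)
    rw [h.hDiff_add hI, hB i (by omega), if_neg (by omega), sub_zero]
  rw [deficit_eq_sum hn hD hB₁, deficit_eq_sum hn (h.isProfile hI hD hd) hB₂,
    ← Finset.sum_Ico_add' (fun j => max 0 (hDiff I' j)) α (max B d) b]
  have hterm : ∀ j, max 0 (hDiff I j) =
      max 0 (hDiff I' (j + b)) + if d ≤ j + b ∧ j < d then 1 else 0 := by
    intro j
    rw [h.hDiff_add hI]
    split_ifs with hj
    · have := hpos j hj.1 hj.2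
      omega
    · rw [sub_zero, add_zero]
  have hcard : ∑ j ∈ Finset.Ico α (max B d), (if d ≤ j + b ∧ j < d then (1 : ℤ) else 0) = b := by
    rw [Finset.sum_boole]
    have : (Finset.Ico α (max B d)).filter (fun j => d ≤ j + b ∧ j < d) =
        Finset.Ico (d - b) d := by
      ext j
      simp only [Finset.mem_filter, Finset.mem_Ico]
      omega
    rw [this, Nat.card_Ico, Nat.sub_sub_self (by omega)]
  rw [Finset.sum_congr rfl fun j _ => hterm j, Finset.sum_add_distrib, hcard]

end

/-- The properties of the output `J` of a run, of either algorithm and of total height `δ`, on an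
ideal `I` of initial degree `α`. They determine `h_{R/J}` and, in low degrees, the local cohomology
of `R/J` in terms of `I` and `δ`. -/
structure IsReduction (I J : Ideal (MvPolynomial (Fin (n + 1)) K))
    (hI : I.IsHomogeneous (homogeneousSubmodule (Fin (n + 1)) K)) (α δ : ℕ) : Prop where
  hDiff_low : ∀ j < α + δ, hDiff J j = 1
  hDiff_high : ∀ j, α ≤ j → hDiff J (j + δ) = min 0 (hDiff I j)
  height_eq : (δ : ℤ) = deficit I
  cohomology : ∃ hJ : J.IsHomogeneous (homogeneousSubmodule (Fin (n + 1)) K),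
    ∀ p, p + 2 ≤ n → ShiftedCohomologyIso hI hJ δ p

theorem IsReduction.refl (hn : 1 ≤ n)
    (hI : I.IsHomogeneous (homogeneousSubmodule (Fin (n + 1)) K))
    (hD : IsProfile (hDiff I) α) (h : deficit I = 0) : IsReduction I I hI α 0 where
  hDiff_low j hj := hD.eq_one j hj
  hDiff_high j hj := (min_eq_right (hDiff_nonpos_of_deficit_eq_zero hn hD h hj)).symm
  height_eq := by rw [h, Nat.cast_zero]
  cohomology := ⟨hI, fun _ _ => ShiftedCohomologyIso.refl⟩

theorem IsReduction.step (hn : 1 ≤ n)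
    (hI : I.IsHomogeneous (homogeneousSubmodule (Fin (n + 1)) K))
    (hD : IsProfile (hDiff I) α) (h : IsBasicDoubleLink I I' d b) (hd : α + b ≤ d)
    (hpos : ∀ j, d ≤ j + b → j < d → 0 < hDiff I j)
    (hJ : IsReduction I' J (h.isHomogeneous hI) (α + b) δ) :
    IsReduction I J hI α (b + δ) where
  hDiff_low j hj := hJ.hDiff_low j (by omega)
  hDiff_high j hj := by
    rw [← add_assoc, hJ.hDiff_high (j + b) (by omega), h.min_hDiff_add hI hpos]
  height_eq := by
    rw [← h.deficit_add hI hD hd hpos hn, ← hJ.height_eq]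
    push_cast
    ring
  cohomology := by
    obtain ⟨hJ', hiso⟩ := hJ.cohomology
    refine ⟨hJ', fun p hp => ?_⟩
    rw [Nat.cast_add]
    exact (h.shiftedCohomologyIso hI (h.isHomogeneous hI) hp).trans (hiso p hp)

theorem FirstAlgorithm.isReduction (hn : 1 ≤ n) {ds : List ℕ} (h : FirstAlgorithm I ds J)
    (hI : I.IsHomogeneous (homogeneousSubmodule (Fin (n + 1)) K)) (hD : IsProfile (hDiff I) α) :
    IsReduction I J hI α ds.sum := by
  induction h generalizing α with
  | finish I res h =>
    refine IsReduction.refl hn hI hD ?_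
    rw [← res.sum_negativeEntries hn hD, MinimalFreeResolution.negativeEntries, h]
    rfl
  | step I I' J res s r tail ds h link next ih =>
    obtain ⟨hs, hsr, hpos⟩ := res.hDiff_pos_of_mem_negativeDiagonal hD
      (by rw [h]; exact List.mem_cons_self)
    rw [List.sum_cons]
    exact IsReduction.step hn hI hD link (by omega) (fun j hj hjr => hpos j (by omega) hjr)
      (ih _ (link.isProfile hI hD (by omega)))

theorem SecondAlgorithm.isReduction (hn : 1 ≤ n) {m : ℕ} (h : SecondAlgorithm I m J)
    (hI : I.IsHomogeneous (homogeneousSubmodule (Fin (n + 1)) K)) (hD : IsProfile (hDiff I) α) :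
    IsReduction I J hI α m := by
  induction h generalizing α with
  | finish I h => exact IsReduction.refl hn hI hD (deficit_eq_zero_of_isOSequence hn hD h)
  | step I I' J i m h least link next ih =>
    obtain ⟨hi, hlt⟩ := least.1
    have hαi : α ≤ i := by
      by_contra! hiα
      rw [hVector_of_lt hn hD i hiα] at hi
      omega
    rw [add_comm m 1]
    refine IsReduction.step hn hI hD link (by omega) (fun j hj hji => ?_)
      (ih _ (link.isProfile hI hD (by omega)))
    -- A basic double link of type `(i + 2, 1)` lowers the difference at `i + 1` only.
    obtain rfl : j = i + 1 := by omega
    rw [hDiff_succ hn]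
    omega

end Step

end

end NumMac

theorem mainTheorem2 {K : Type*} [Field K] [Infinite K] (n : ℕ)
    (I : Ideal (MvPolynomial (Fin (n + 1)) K))
    (hI : I.IsHomogeneous (MvPolynomial.homogeneousSubmodule (Fin (n + 1)) K))
    (hcodim : 2 ≤ I.height)
    (hCM : ¬ NumMac.IsCohenMacaulayIdeal I)
    (J : Ideal (MvPolynomial (Fin (n + 1)) K)) (ds : List ℕ)
    (hJ : NumMac.FirstAlgorithm I ds J)
    (J' : Ideal (MvPolynomial (Fin (n + 1)) K)) (m : ℕ)
    (hJ' : NumMac.SecondAlgorithm I m J') :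
    NumMac.hilbertFunction J = NumMac.hilbertFunction J' ∧
    (Function.support (NumMac.hVector I)).Finite ∧
    (ds.sum : ℤ) = NumMac.deficit I ∧
    (m : ℤ) = NumMac.deficit I ∧
    (∀ res : NumMac.MinimalFreeResolution I,
      (res.negativeEntries.sum : ℤ) = NumMac.deficit I) ∧
    ∀ i : ℕ, i + 2 ≤ n → NumMac.GradedLocalCohomologyIso J J' i := by
  have hn : 1 ≤ n := (NumMac.two_le_of_not_isCohenMacaulayIdeal hcodim hCM).trans' one_le_two
  have htop : I ≠ ⊤ := by
    rintro rfl
    refine hCM (NumMac.isCohenMacaulayIdeal_of_ringKrullDim_le_zero ?_)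
    have := Ideal.Quotient.subsingleton_iff.2 (rfl : (⊤ : Ideal (MvPolynomial (Fin (n + 1)) K)) = ⊤)
    rw [ringKrullDim_eq_bot_of_subsingleton]
    exact bot_le
  have hV : ∃ B, ∀ j, B ≤ j → NumMac.hVector I j = 0 := by
    have ⟨res⟩ : Nonempty (NumMac.MinimalFreeResolution I) := by cases hJ <;> exact ⟨‹_›⟩
    exact NumMac.hVector_eventually_zero hn hI htop hcodim res
  obtain ⟨α, hD⟩ := NumMac.exists_isProfile hn hI htop (NumMac.ne_bot_of_two_le_height hcodim) hV
  have h₁ := hJ.isReduction hn hI hD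
  have h₂ := hJ'.isReduction hn hI hD
  have hδ : m = ds.sum := by exact_mod_cast h₂.height_eq.trans h₁.height_eq.symm
  rw [hδ] at h₂
  refine ⟨?_, ?_, h₁.height_eq, by rw [hδ]; exact h₁.height_eq,
    fun res => res.sum_negativeEntries hn hD, fun i hi => ?_⟩
  · refine NumMac.hilbertFunction_eq_of_hDiff_eq (funext fun j => ?_)
    by_cases hj : j < α + ds.sum
    · rw [h₁.hDiff_low j hj, h₂.hDiff_low j hj]
    · obtain ⟨k, rfl⟩ := Nat.exists_eq_add_of_le' (show ds.sum ≤ j by omega)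
      rw [h₁.hDiff_high k (by omega), h₂.hDiff_high k (by omega)]
  · obtain ⟨B, hB⟩ := hV
    refine (Set.finite_lt_nat B).subset fun j hj => ?_
    by_contra h
    exact hj (hB j (not_lt.1 h))
  · obtain ⟨hJh, hiso₁⟩ := h₁.cohomology
    obtain ⟨hJh', hiso₂⟩ := h₂.cohomology
    have hiso := (hiso₁ i hi).symm.trans (hiso₂ i hi)
    rw [neg_add_cancel] at hiso
    exact hiso.gradedLocalCohomologyIso
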